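/- Let $\lambda = 2\cos(\pi/5)$, let $\mathbb Z[\lambda]\subset\mathbb R$ be the subring generated by $\lambda$, and let $G_5\subset PSL_2(\mathbb R)$ be the Hecke group generated by $z\mapsto -1/z$ and $z\mapsto z+\lambda$. For $\tau\in\mathbb Z[\lambda]$ let $G_0(\tau)$ be the subgroup of all elements of $G_5$ that are represented by a matrix whose $(2,1)$-entry is a multiple of $\tau$ in $\mathbb Z[\lambda]$. Let $\tau\in\mathbb Z[\lambda]$ be nonzero, and let $h$ be the largest positive integer dividing $4$ such that $h^2$ divides $\tau$ in $\mathbb Z[\lambda]$. Then the normaliser of $G_0(\tau)$ in $PSL_2(\mathbb R)$ is $G_0(\tau/h)$. -/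

import Mathlib

namespace HeckeFive

/-- The real number `λ = 2 cos (π / 5)`. -/
noncomputable def lam : ℝ := 2 * Real.cos (Real.pi / 5)

/-- The ring `ℤ[λ]`, as a subring of the reals. -/
abbrev ZLam : Subalgebra ℤ ℝ := Algebra.adjoin ℤ {lam}

/-- `PSL₂(ℝ)`, the quotient of `SL₂(ℝ)` by its centre `{±1}`. -/
abbrev PSL2R : Type := Matrix.ProjectiveSpecialLinearGroup (Fin 2) ℝ

/-- The quotient map `SL₂(ℝ) → PSL₂(ℝ)`. -/
def toPSL : Matrix.SpecialLinearGroup (Fin 2) ℝ →* PSL2R :=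
  QuotientGroup.mk' (Subgroup.center (Matrix.SpecialLinearGroup (Fin 2) ℝ))

/-- The matrix of `z ↦ -1 / z`. -/
def matS : Matrix.SpecialLinearGroup (Fin 2) ℝ :=
  ⟨!![0, -1; 1, 0], by simp [Matrix.det_fin_two_of]⟩

/-- The matrix of `z ↦ z + λ`. -/
noncomputable def matT : Matrix.SpecialLinearGroup (Fin 2) ℝ :=
  ⟨!![1, lam; 0, 1], by simp [Matrix.det_fin_two_of]⟩

/-- The Hecke group `G₅`: the subgroup of `PSL₂(ℝ)` generated by `z ↦ -1 / z` and `z ↦ z + λ`. -/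
noncomputable def G5 : Subgroup PSL2R := Subgroup.closure {toPSL matS, toPSL matT}

/-- The matrices in `SL₂(ℝ)` with entries in `ℤ[λ]`. -/
def intSL : Subgroup (Matrix.SpecialLinearGroup (Fin 2) ℝ) where
  carrier := {A | ∀ i j, A i j ∈ ZLam}
  one_mem' i j := by
    fin_cases i <;> fin_cases j <;> simp [ZLam.one_mem, ZLam.zero_mem]
  mul_mem' {A B} hA hB i j := by
    rw [Matrix.SpecialLinearGroup.coe_mul, Matrix.mul_apply]
    exact ZLam.sum_mem fun k _ => ZLam.mul_mem (hA i k) (hB k j)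
  inv_mem' {A} hA i j := by
    rw [Matrix.SpecialLinearGroup.coe_inv, Matrix.adjugate_fin_two]
    fin_cases i <;> fin_cases j
    · exact hA 1 1
    · exact ZLam.neg_mem (hA 0 1)
    · exact ZLam.neg_mem (hA 1 0)
    · exact hA 0 0

lemma G5_le_map_intSL : G5 ≤ intSL.map toPSL := by
  refine (Subgroup.closure_le _).2 ?_
  rintro g (rfl | rfl)
  · refine ⟨matS, ?_, rfl⟩
    intro i j
    fin_cases i <;> fin_cases j <;>
      simp [matS, ZLam.one_mem, ZLam.zero_mem]
  · refine ⟨matT, ?_, rfl⟩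
    intro i j
    fin_cases i <;> fin_cases j <;>
      simp [matT, ZLam.one_mem, ZLam.zero_mem]

lemma center_le_intSL : Subgroup.center (Matrix.SpecialLinearGroup (Fin 2) ℝ) ≤ intSL := by
  intro A hA
  obtain ⟨r, hr, hrA⟩ := Matrix.SpecialLinearGroup.mem_center_iff.1 hA
  have hr' : r = 1 ∨ r = -1 := by
    simpa using hr
  have hrm : r ∈ ZLam := by
    rcases hr' with h | h <;> rw [h]
    · exact ZLam.one_mem
    · exact ZLam.neg_mem ZLam.one_mem
  intro i j
  rw [← hrA, Matrix.scalar_apply, Matrix.diagonal_apply]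
  split_ifs
  · exact hrm
  · exact ZLam.zero_mem

/-- Every matrix that represents an element of `G₅` has its entries in `ℤ[λ]`. -/
lemma entry_mem {A : Matrix.SpecialLinearGroup (Fin 2) ℝ} (hA : toPSL A ∈ G5) (i j : Fin 2) :
    A i j ∈ ZLam := by
  obtain ⟨B, hB, hBA⟩ := G5_le_map_intSL hA
  have h : B⁻¹ * A ∈ Subgroup.center (Matrix.SpecialLinearGroup (Fin 2) ℝ) :=
    QuotientGroup.eq.1 hBA
  have h2 : A ∈ intSL := by
    have := intSL.mul_mem hB (center_le_intSL h)
    rwa [mul_inv_cancel_left] at this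
  exact h2 i j

/-- `G₀(τ)`: the elements of `G₅` that are represented by a matrix whose `(2, 1)`-entry is a
multiple of `τ` in `ℤ[λ]` (the two representing matrices differ by a sign, so that the choice of
the matrix does not matter). -/
def G0 (τ : ZLam) : Subgroup PSL2R where
  carrier := {g | g ∈ G5 ∧
    ∃ A : Matrix.SpecialLinearGroup (Fin 2) ℝ, toPSL A = g ∧ ∃ k : ZLam, A 1 0 = (τ * k : ZLam)}
  one_mem' := ⟨G5.one_mem, 1, map_one _, 0, by simp⟩
  mul_mem' := by
    rintro _ _ ⟨hg, A, rfl, k, hk⟩ ⟨hh, B, rfl, l, hl⟩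
    refine ⟨G5.mul_mem hg hh, A * B, map_mul _ _ _,
      k * ⟨B 0 0, entry_mem hh 0 0⟩ + ⟨A 1 1, entry_mem hg 1 1⟩ * l, ?_⟩
    rw [Matrix.SpecialLinearGroup.coe_mul, Matrix.mul_apply, Fin.sum_univ_two, hk, hl]
    push_cast
    ring
  inv_mem' := by
    rintro _ ⟨hg, A, rfl, k, hk⟩
    refine ⟨G5.inv_mem hg, A⁻¹, map_inv _ _, -k, ?_⟩
    rw [Matrix.SpecialLinearGroup.coe_inv, Matrix.adjugate_fin_two]
    simp [hk]

end HeckeFive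

namespace HeckeFive

/-! ### The ring `ℤ[λ]` -/

/-! Upper bound. Let g normalise G₀(τ), and let m be a positive integer divisible by τ. All
G₅-conjugates of z ↦ z + mλ lie in G₀(τ), so g conjugates them into G₅. Hence g maps cusps to cusps
and scales their columns by factors whose squares are rational, being ratios of translation lengths
(`mem_of_conj_parabolic`). This already forces g ∈ G₅ (`PermutesCols.mem`), for three reasons: every
vector over ℤ[λ] is a multiple of a column of G₅ (`exists_isCol`), a unit with rational square is
±1, and nonzero column entries have absolute value at least 1 (`NonnegCol.gap`), which pins down the
columns with second entry 1 or λ.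

Now let g ∈ G₅ have lower left entry c. Conjugating z ↦ z + λ gives τ ∣ c²; conjugating the rest of
G₀(τ) gives τ ∣ c(x − w) for all diagonals (x, w) occurring there. Explicit words in G₀(τ) then
yield τ ∣ 4c (`dvd_four_mul`), and since 2 is prime in ℤ[λ] and h is maximal, τ/h divides c
(`dvd_of_dvd_four_mul_of_dvd_sq`).

Lower bound. Conjugation by G₀(τ/h) preserves G₀(τ) once h ∣ x − w for all these diagonals. For even
h this holds because G₅ preserves P² + λPQ + Q² modulo 2 (`NonnegCol.form`, `four_dvd_sq_sub_one`).
-/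

lemma lam_eq : lam = Real.goldenRatio := by
  rw [lam, Real.cos_pi_div_five, Real.goldenRatio]; ring

lemma lam_sq : lam ^ 2 = lam + 1 := by
  rw [lam_eq]; exact Real.goldenRatio_sq

lemma lam_gt : 1.618 < lam := by
  have h := lam_sq
  have : 1 < lam := by rw [lam_eq]; exact Real.one_lt_goldenRatio
  nlinarith

lemma lam_lt : lam < 1.6181 := by
  have h := lam_sq
  have := lam_gt
  nlinarith

lemma lam_pos : 0 < lam := by linarith [lam_gt]

lemma int_add_mul_lam_inj {a b c d : ℤ} (h : (a : ℝ) + b * lam = c + d * lam) : a = c ∧ b = d := by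
  have hb : b = d := by
    by_contra hne
    have hirr : Irrational lam := by rw [lam_eq]; exact Real.goldenRatio_irrational
    have hne' : ((b : ℝ) - d) ≠ 0 := sub_ne_zero.2 (by exact_mod_cast hne)
    refine hirr ⟨((c - a : ℤ) : ℚ) / ((b - d : ℤ) : ℚ), ?_⟩
    push_cast
    rw [div_eq_iff hne']
    linarith
  subst hb
  exact ⟨by exact_mod_cast (add_right_cancel h), rfl⟩

lemma lam_mem : lam ∈ ZLam := Algebra.subset_adjoin rfl

lemma int_mem (a : ℤ) : (a : ℝ) ∈ ZLam := by
  simp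

lemma mem_ZLam_iff {x : ℝ} : x ∈ ZLam ↔ ∃ a b : ℤ, x = a + b * lam := by
  constructor
  · intro hx
    induction hx using Algebra.adjoin_induction with
    | mem x hx => exact ⟨0, 1, by simp [Set.mem_singleton_iff.1 hx]⟩
    | algebraMap r => exact ⟨r, 0, by simp⟩
    | add x y _ _ hx hy =>
      obtain ⟨a, b, rfl⟩ := hx
      obtain ⟨c, d, rfl⟩ := hy
      exact ⟨a + c, b + d, by push_cast; ring⟩
    | mul x y _ _ hx hy =>
      obtain ⟨a, b, rfl⟩ := hx
      obtain ⟨c, d, rfl⟩ := hy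
      exact ⟨a * c + b * d, a * d + b * c + b * d, by
        push_cast; linear_combination (b : ℝ) * d * lam_sq⟩
  · rintro ⟨a, b, rfl⟩
    exact ZLam.add_mem (int_mem a) (ZLam.mul_mem (int_mem b) lam_mem)

/-- The generator `λ` as an element of `ℤ[λ]`. -/
noncomputable def gen : ZLam := ⟨lam, lam_mem⟩

lemma gen_sq : gen ^ 2 = gen + 1 := Subtype.ext (by simpa [gen] using lam_sq)

lemma exists_int_add_mul_gen (x : ZLam) : ∃ a b : ℤ, x = a + b * gen := by
  obtain ⟨a, b, h⟩ := mem_ZLam_iff.1 x.2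
  exact ⟨a, b, Subtype.ext (by simpa [gen] using h)⟩

lemma int_add_mul_gen_inj {a b c d : ℤ} (h : (a : ZLam) + b * gen = c + d * gen) :
    a = c ∧ b = d :=
  int_add_mul_lam_inj (by simpa [gen] using congrArg (Subtype.val) h)

lemma exists_int_of_rat_mem {x : ℝ} (hx : x ∈ ZLam) {r : ℚ} (hr : x = r) : ∃ n : ℤ, x = n := by
  obtain ⟨a, b, h⟩ := mem_ZLam_iff.1 hx
  have h1 : (r.den : ℝ) * x = r.num := by
    rw [hr]; exact_mod_cast Rat.den_mul_eq_num r
  have := int_add_mul_lam_inj (a := r.den * a) (b := r.den * b) (c := r.num) (d := 0) (by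
    push_cast; rw [← h1, h]; ring)
  have hb : b = 0 := by
    rcases mul_eq_zero.1 this.2 with h | h
    · exact absurd h (by exact_mod_cast r.den_ne_zero)
    · exact h
  exact ⟨a, by simp [h, hb]⟩

/-- A unit of `ℤ[λ]` with a rational square is `±1`. -/
lemma eq_one_or_neg_one_of_sq_rat {f g : ℝ} (hf : f ∈ ZLam) (hg : g ∈ ZLam) (hfg : f * g = 1)
    {r : ℚ} (hr : f ^ 2 = r) : f = 1 ∨ f = -1 := by
  -- Both f² and its inverse g² are rational elements of ℤ[λ], hence integers with product 1.
  obtain ⟨a, ha⟩ := exists_int_of_rat_mem (ZLam.pow_mem hf 2) hr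
  obtain ⟨b, hb⟩ := exists_int_of_rat_mem (r := r⁻¹) (ZLam.pow_mem hg 2) (by
    push_cast; rw [← hr, ← inv_pow, eq_inv_of_mul_eq_one_right hfg])
  have hab : a * b = 1 := by
    have : (a : ℝ) * b = 1 := by rw [← ha, ← hb, ← mul_pow, hfg, one_pow]
    exact_mod_cast this
  have ha0 : (0 : ℝ) ≤ a := ha ▸ sq_nonneg f
  have ha0 : 0 ≤ a := by exact_mod_cast ha0
  have : a = 1 := by
    rcases Int.eq_one_or_neg_one_of_mul_eq_one hab with h | h
    · exact h
    · omega
  rw [this] at ha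
  exact mul_self_eq_one_iff.1 (by rw [← sq, ha, Int.cast_one])

lemma two_dvd_iff {a b : ℤ} : (2 : ZLam) ∣ a + b * gen ↔ 2 ∣ a ∧ 2 ∣ b := by
  constructor
  · rintro ⟨k, hk⟩
    obtain ⟨c, d, rfl⟩ := exists_int_add_mul_gen k
    have := int_add_mul_gen_inj (a := a) (b := b) (c := 2 * c) (d := 2 * d)
      (by push_cast; rw [hk]; ring)
    exact ⟨⟨c, this.1⟩, ⟨d, this.2⟩⟩
  · rintro ⟨⟨c, rfl⟩, ⟨d, rfl⟩⟩
    exact ⟨c + d * gen, by push_cast; ring⟩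

/-- The prime 2 is inert because x² − x − 1 is irreducible modulo 2; on coordinates this is a parity
check. -/
lemma prime_two : Prime (2 : ZLam) := by
  refine ⟨two_ne_zero, ?_, ?_⟩
  · intro h
    have : (2 : ZLam) ∣ ((1 : ℤ) : ZLam) + (0 : ℤ) * gen := by simpa using h.dvd
    have := (two_dvd_iff.1 this).1
    omega
  · intro x y h
    obtain ⟨a, b, rfl⟩ := exists_int_add_mul_gen x
    obtain ⟨c, d, rfl⟩ := exists_int_add_mul_gen y
    have e : ((a : ZLam) + b * gen) * (c + d * gen) =
        ((a * c + b * d : ℤ) : ZLam) + ((a * d + b * c + b * d : ℤ) : ZLam) * gen := by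
      push_cast; linear_combination (b : ZLam) * d * gen_sq
    rw [e, two_dvd_iff] at h
    rw [two_dvd_iff, two_dvd_iff]
    obtain ⟨h1, h2⟩ := h
    simp only [← even_iff_two_dvd, Int.even_add, Int.even_mul] at h1 h2 ⊢
    tauto

/-- The Galois conjugate of `a + b λ`. -/
noncomputable def conj (a b : ℤ) : ℝ := a + b * (1 - lam)

lemma eq_zero_of_abs_norm_lt_one {a b : ℤ} (h : |(a + b * lam) * conj a b| < 1) :
    a = 0 ∧ b = 0 := by
  have e : ((a : ℝ) + b * lam) * conj a b = ((a ^ 2 + a * b - b ^ 2 : ℤ) : ℝ) := by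
    rw [conj]; push_cast; linear_combination -(b : ℝ) ^ 2 * lam_sq
  have h0 : a ^ 2 + a * b - b ^ 2 = 0 := by
    rw [e] at h
    exact Int.abs_lt_one_iff.1 (by exact_mod_cast h)
  have h1 : ((a : ℝ) + b * lam) * ((a + b : ℤ) + (-b : ℤ) * lam) = 0 := by
    rw [h0] at e; rw [← Int.cast_zero, ← e, conj]; push_cast; ring
  rcases mul_eq_zero.1 h1 with h | h
  · exact int_add_mul_lam_inj (c := 0) (d := 0) (by simpa using h)
  · have := int_add_mul_lam_inj (c := 0) (d := 0) (by rw [h]; simp)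
    omega

open Matrix

/-! ### The preimage of the Hecke group in `SL₂(ℝ)` and its columns -/

/-- The preimage of `G₅` in `SL₂(ℝ)`. -/
noncomputable def SLG5 : Subgroup (Matrix.SpecialLinearGroup (Fin 2) ℝ) := G5.comap toPSL

lemma mem_SLG5 {A : Matrix.SpecialLinearGroup (Fin 2) ℝ} : A ∈ SLG5 ↔ toPSL A ∈ G5 := Iff.rfl

lemma toPSL_eq_iff {A B : Matrix.SpecialLinearGroup (Fin 2) ℝ} :
    toPSL A = toPSL B ↔ B = A ∨ B = -A := by
  have h1 : toPSL A = toPSL B ↔ A⁻¹ * B ∈ Subgroup.center (Matrix.SpecialLinearGroup (Fin 2) ℝ) :=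
    QuotientGroup.eq
  have h2 : A⁻¹ * B ∈ Subgroup.center (Matrix.SpecialLinearGroup (Fin 2) ℝ) ↔
      A⁻¹ * B = 1 ∨ A⁻¹ * B = -1 := by
    rw [Matrix.SpecialLinearGroup.mem_center_iff]
    constructor
    · rintro ⟨r, hr, h⟩
      have hr' : r = 1 ∨ r = -1 := by simpa using hr
      rcases hr' with rfl | rfl
      · left; ext i j; rw [← h]; fin_cases i <;> fin_cases j <;> simp
      · right; ext i j; rw [← h]; fin_cases i <;> fin_cases j <;> simp
    · rintro (h | h)
      · exact ⟨1, by simp, by rw [h]; simp⟩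
      · refine ⟨-1, by simp, ?_⟩
        rw [h]; ext i j; fin_cases i <;> fin_cases j <;> simp
  rw [h1, h2, inv_mul_eq_iff_eq_mul, inv_mul_eq_iff_eq_mul, mul_one, mul_neg, mul_one]

lemma toPSL_neg (A : Matrix.SpecialLinearGroup (Fin 2) ℝ) : toPSL (-A) = toPSL A :=
  (toPSL_eq_iff.2 (Or.inr rfl)).symm

lemma neg_mem_SLG5 {A : Matrix.SpecialLinearGroup (Fin 2) ℝ} (hA : A ∈ SLG5) : -A ∈ SLG5 := by
  rw [mem_SLG5, toPSL_neg]; exact hA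

lemma matS_mem : matS ∈ SLG5 := Subgroup.subset_closure (by simp)

lemma matT_mem : matT ∈ SLG5 := Subgroup.subset_closure (by simp)

lemma det_eq (A : Matrix.SpecialLinearGroup (Fin 2) ℝ) : A 0 0 * A 1 1 - A 0 1 * A 1 0 = 1 := by
  rw [← Matrix.det_fin_two]; exact A.det_coe

lemma mul_entry (A B : Matrix.SpecialLinearGroup (Fin 2) ℝ) (i j : Fin 2) :
    (A * B) i j = A i 0 * B 0 j + A i 1 * B 1 j := by
  rw [Matrix.SpecialLinearGroup.coe_mul, Matrix.mul_apply, Fin.sum_univ_two]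

lemma inv_entries (A : Matrix.SpecialLinearGroup (Fin 2) ℝ) :
    A⁻¹ 0 0 = A 1 1 ∧ A⁻¹ 0 1 = -A 0 1 ∧ A⁻¹ 1 0 = -A 1 0 ∧ A⁻¹ 1 1 = A 0 0 := by
  simp [Matrix.adjugate_fin_two]

/-- The upper triangular unipotent matrix with entry `x`. -/
def upper (x : ℝ) : Matrix.SpecialLinearGroup (Fin 2) ℝ := ⟨!![1, x; 0, 1], by simp [det_fin_two_of]⟩

/-- The lower triangular unipotent matrix with entry `x`. -/
def lower (x : ℝ) : Matrix.SpecialLinearGroup (Fin 2) ℝ := ⟨!![1, 0; x, 1], by simp [det_fin_two_of]⟩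

lemma upper_mul (x y : ℝ) : upper x * upper y = upper (x + y) := by
  ext i j; rw [mul_entry]; fin_cases i <;> fin_cases j <;> simp [upper, add_comm]

lemma upper_lam_mem (k : ℤ) : upper (k * lam) ∈ SLG5 := by
  have hnat : ∀ n : ℕ, upper (n * lam) ∈ SLG5 := by
    intro n
    induction n with
    | zero =>
      have : upper ((0 : ℕ) * lam) = 1 := by
        ext i j; fin_cases i <;> fin_cases j <;> simp [upper]
      rw [this]; exact SLG5.one_mem
    | succ n ih =>
      have := SLG5.mul_mem ih matT_mem
      have e : matT = upper lam := rfl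
      rw [e, upper_mul] at this
      convert this using 2
      push_cast; ring
  obtain ⟨n, rfl | rfl⟩ := k.eq_nat_or_neg
  · exact_mod_cast hnat n
  · have := SLG5.inv_mem (hnat n)
    convert this using 1
    rw [eq_inv_iff_mul_eq_one, upper_mul]
    ext i j; fin_cases i <;> fin_cases j <;> simp [upper]

lemma lower_eq (x : ℝ) : lower x = matS * upper (-x) * matS⁻¹ := by
  rw [eq_mul_inv_iff_mul_eq]
  ext i j; rw [mul_entry, mul_entry]; fin_cases i <;> fin_cases j <;> simp [upper, lower, matS]

lemma lower_lam_mem (k : ℤ) : lower (k * lam) ∈ SLG5 := by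
  rw [lower_eq]
  refine SLG5.mul_mem (SLG5.mul_mem matS_mem ?_) (SLG5.inv_mem matS_mem)
  have := upper_lam_mem (-k)
  rwa [Int.cast_neg, neg_mul] at this

/-- `(p, q)` is the first column of a matrix in the preimage of `G₅`. -/
def IsCol (p q : ℝ) : Prop := ∃ A ∈ SLG5, A 0 0 = p ∧ A 1 0 = q

lemma IsCol.smul {p q : ℝ} (h : IsCol p q) {A : Matrix.SpecialLinearGroup (Fin 2) ℝ} (hA : A ∈ SLG5) :
    IsCol (A 0 0 * p + A 0 1 * q) (A 1 0 * p + A 1 1 * q) := by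
  obtain ⟨B, hB, rfl, rfl⟩ := h
  exact ⟨A * B, SLG5.mul_mem hA hB, mul_entry _ _ _ _, mul_entry _ _ _ _⟩

lemma IsCol.neg {p q : ℝ} (h : IsCol p q) : IsCol (-p) (-q) := by
  obtain ⟨A, hA, rfl, rfl⟩ := h
  exact ⟨-A, neg_mem_SLG5 hA, by simp, by simp⟩

lemma IsCol.swap {p q : ℝ} (h : IsCol p q) : IsCol (-q) p := by
  simpa [matS] using h.smul matS_mem

lemma IsCol.shift {p q : ℝ} (h : IsCol p q) (k : ℤ) : IsCol (p + k * lam * q) q := by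
  simpa [upper] using h.smul (upper_lam_mem k)

lemma IsCol.of_first {A : Matrix.SpecialLinearGroup (Fin 2) ℝ} (hA : A ∈ SLG5) :
    IsCol (A 0 0) (A 1 0) := ⟨A, hA, rfl, rfl⟩

lemma IsCol.one_zero : IsCol 1 0 := ⟨1, SLG5.one_mem, by simp, by simp⟩

lemma IsCol.of_second {A : Matrix.SpecialLinearGroup (Fin 2) ℝ} (hA : A ∈ SLG5) :
    IsCol (A 0 1) (A 1 1) := by
  simpa using (IsCol.one_zero.swap).smul hA

lemma IsCol.mem {p q : ℝ} (h : IsCol p q) : p ∈ ZLam ∧ q ∈ ZLam := by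
  obtain ⟨A, hA, rfl, rfl⟩ := h
  exact ⟨entry_mem hA _ _, entry_mem hA _ _⟩

lemma IsCol.bezout {p q : ℝ} (h : IsCol p q) : ∃ x ∈ ZLam, ∃ y ∈ ZLam, x * p + y * q = 1 := by
  obtain ⟨A, hA, rfl, rfl⟩ := h
  exact ⟨A 1 1, entry_mem hA _ _, -A 0 1, ZLam.neg_mem (entry_mem hA _ _), by
    linear_combination det_eq A⟩

/-- The columns of the products of the four nonnegative matrices `±(TS)ᵏS`, `1 ≤ k ≤ 4`. -/
inductive NonnegCol : ℝ → ℝ → Prop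
  | left : NonnegCol 1 0
  | right : NonnegCol 0 1
  | one {p q : ℝ} : NonnegCol p q → NonnegCol (p + lam * q) q
  | two {p q : ℝ} : NonnegCol p q → NonnegCol (lam * (p + q)) (p + lam * q)
  | three {p q : ℝ} : NonnegCol p q → NonnegCol (lam * p + q) (lam * (p + q))
  | four {p q : ℝ} : NonnegCol p q → NonnegCol p (lam * p + q)

lemma NonnegCol.swap {p q : ℝ} (h : NonnegCol p q) : NonnegCol q p := by
  induction h with
  | left => exact .right
  | right => exact .left
  | one _ ih => rw [add_comm]; exact ih.four
  | two _ ih => convert ih.three using 1 <;> ring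
  | three _ ih => convert ih.two using 1 <;> ring
  | four _ ih => rw [add_comm]; exact ih.one

lemma NonnegCol.nonneg {p q : ℝ} (h : NonnegCol p q) : 0 ≤ p ∧ 0 ≤ q := by
  have hl := lam_pos
  induction h with
  | left => norm_num
  | right => norm_num
  | one _ ih => obtain ⟨h1, h2⟩ := ih; constructor <;> positivity
  | two _ ih => obtain ⟨h1, h2⟩ := ih; constructor <;> positivity
  | three _ ih => obtain ⟨h1, h2⟩ := ih; constructor <;> positivity
  | four _ ih => obtain ⟨h1, h2⟩ := ih; constructor <;> positivity

/-- Up to sign, T⁻¹ strips off a step `one` and turns a last step `two`, `three`, `four` into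
`four`, `three`, `two` applied to the swapped vector. -/
lemma NonnegCol.abs_sub {p q : ℝ} (h : NonnegCol p q) : NonnegCol |p - lam * q| q := by
  have hl := lam_pos
  have hl2 := lam_sq
  cases h with
  | left => simpa using NonnegCol.left
  | right => simpa [abs_of_pos hl] using NonnegCol.right.one
  | @one p q h => simpa [abs_of_nonneg h.nonneg.1] using h
  | @two p q h =>
    have e : lam * (p + q) - lam * (p + lam * q) = -q := by linear_combination -q * hl2
    rw [e, abs_neg, abs_of_nonneg h.nonneg.2, add_comm p]
    exact h.swap.four
  | @three p q h =>
    have e : lam * p + q - lam * (lam * (p + q)) = -(p + lam * q) := by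
      linear_combination -(p + q) * hl2
    have := h.nonneg
    rw [e, abs_neg, abs_of_nonneg (by nlinarith)]
    convert h.swap.three using 1 <;> ring
  | @four p q h =>
    have e : p - lam * (lam * p + q) = -(lam * (p + q)) := by
      linear_combination -p * hl2
    have := h.nonneg
    rw [e, abs_neg, abs_of_nonneg (by nlinarith), add_comm (lam * p), add_comm p]
    exact h.swap.two

lemma NonnegCol.abs_add {p q : ℝ} (h : NonnegCol |p| |q|) : NonnegCol |p + lam * q| |q| := by
  have hl := lam_pos
  have key : |p + lam * q| = |p| + lam * |q| ∨ |p + lam * q| = |(|p| - lam * |q|)| := by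
    rcases abs_cases p with ⟨h1, _⟩ | ⟨h1, _⟩ <;> rcases abs_cases q with ⟨h2, _⟩ | ⟨h2, _⟩ <;>
      rw [h1, h2]
    · left; rw [abs_of_nonneg (by positivity)]
    · right; ring_nf
    · right; rw [← abs_neg]; ring_nf
    · left; rw [abs_of_nonpos (by nlinarith)]; ring
  rcases key with e | e <;> rw [e]
  · exact h.one
  · exact h.abs_sub

/-- Taking absolute values extends the monoid description to the whole group: it suffices to treat
S, T and T⁻¹, and the equivalence makes the induction pass to inverses. -/
lemma nonnegCol_mul_iff {A : Matrix.SpecialLinearGroup (Fin 2) ℝ} (hA : A ∈ SLG5) (p q : ℝ) :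
    NonnegCol |A 0 0 * p + A 0 1 * q| |A 1 0 * p + A 1 1 * q| ↔ NonnegCol |p| |q| := by
  have hneg : ∀ (A : Matrix.SpecialLinearGroup (Fin 2) ℝ) (p q : ℝ),
      NonnegCol |(-A) 0 0 * p + (-A) 0 1 * q| |(-A) 1 0 * p + (-A) 1 1 * q| ↔
      NonnegCol |A 0 0 * p + A 0 1 * q| |A 1 0 * p + A 1 1 * q| := by
    intro A p q
    rw [← abs_neg (A 0 0 * p + _), ← abs_neg (A 1 0 * p + _)]
    simp [add_comm]
  suffices ∀ g ∈ G5, ∀ A : Matrix.SpecialLinearGroup (Fin 2) ℝ, toPSL A = g → ∀ p q,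
      NonnegCol |A 0 0 * p + A 0 1 * q| |A 1 0 * p + A 1 1 * q| ↔ NonnegCol |p| |q| from
    this _ hA A rfl p q
  intro g hg
  induction hg using Subgroup.closure_induction with
  | mem g hg =>
    intro A hA p q
    have hsub : ∀ p q : ℝ, NonnegCol |p| |q| → NonnegCol |p - lam * q| |q| := by
      intro p q h
      have := NonnegCol.abs_add (p := p) (q := -q) (by simpa using h)
      simpa [sub_eq_add_neg] using this
    rcases hg with rfl | rfl <;> rcases toPSL_eq_iff.1 hA.symm with rfl | rfl <;>
      (try rw [hneg])
    · simpa [matS] using ⟨NonnegCol.swap, NonnegCol.swap⟩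
    · simpa [matS] using ⟨NonnegCol.swap, NonnegCol.swap⟩
    all_goals
      simp only [matT, of_apply, cons_val', cons_val_zero, cons_val_one, cons_val_fin_one, one_mul,
        zero_mul, zero_add]
      refine ⟨fun h => ?_, NonnegCol.abs_add⟩
      simpa using hsub _ _ h
  | one =>
    intro A hA p q
    rcases toPSL_eq_iff.1 ((map_one toPSL).trans hA.symm) with rfl | rfl
    · simp
    · rw [hneg]; simp
  | mul x y _ _ hx hy =>
    intro A hA p q
    obtain ⟨B, rfl⟩ := QuotientGroup.mk'_surjective _ x
    obtain ⟨C, rfl⟩ : ∃ C, A = B * C := ⟨B⁻¹ * A, (mul_inv_cancel_left B A).symm⟩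
    have e : toPSL C = y := mul_left_cancel ((map_mul toPSL B C).symm.trans hA)
    rw [← hy C e p q, ← hx B rfl (C 0 0 * p + C 0 1 * q)]
    simp only [mul_entry]
    ring_nf
  | inv x _ hx =>
    intro A hA p q
    have e : toPSL A⁻¹ = x := by rw [map_inv, hA, inv_inv]
    obtain ⟨e1, e2, e3, e4⟩ := inv_entries A
    have := hx _ e (A 0 0 * p + A 0 1 * q) (A 1 0 * p + A 1 1 * q)
    rw [← this, e1, e2, e3, e4]
    have d := det_eq A
    have a1 : A 1 1 * (A 0 0 * p + A 0 1 * q) + -A 0 1 * (A 1 0 * p + A 1 1 * q) = p := by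
      linear_combination p * d
    have a2 : -A 1 0 * (A 0 0 * p + A 0 1 * q) + A 0 0 * (A 1 0 * p + A 1 1 * q) = q := by
      linear_combination q * d
    rw [a1, a2]

lemma IsCol.nonnegCol {p q : ℝ} (h : IsCol p q) : NonnegCol |p| |q| := by
  obtain ⟨A, hA, rfl, rfl⟩ := h
  simpa using (nonnegCol_mul_iff hA 1 0).2 (by simpa using NonnegCol.left)

/-- The four generators have entries in {0, 1, λ} with λ > 1, so no entry can fall strictly between
0 and 1. This plays the role of discreteness. -/
lemma NonnegCol.gap {p q : ℝ} (h : NonnegCol p q) :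
    (p = 0 ∧ q = 1) ∨ (p = 1 ∧ q = 0) ∨ (1 ≤ p ∧ 1 ≤ q) := by
  have hl := lam_gt
  induction h with
  | left => simp
  | right => simp
  | one h ih =>
    rcases ih with ⟨rfl, rfl⟩ | ⟨rfl, rfl⟩ | ⟨h1, h2⟩
    · right; right; constructor <;> linarith
    · simp
    · right; right; constructor <;> nlinarith
  | two h ih =>
    right; right
    rcases ih with ⟨rfl, rfl⟩ | ⟨rfl, rfl⟩ | ⟨h1, h2⟩ <;> constructor <;> nlinarith
  | three h ih =>
    right; right
    rcases ih with ⟨rfl, rfl⟩ | ⟨rfl, rfl⟩ | ⟨h1, h2⟩ <;> constructor <;> nlinarith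
  | four h ih =>
    rcases ih with ⟨rfl, rfl⟩ | ⟨rfl, rfl⟩ | ⟨h1, h2⟩
    · simp
    · right; right; constructor <;> linarith
    · right; right; constructor <;> nlinarith

/-- By the gap, every step other than `one` reaches second entry 1 only from a basis vector, while
`one` adds λ to p. The case of second entry λ below works in the same way. -/
lemma NonnegCol.of_snd_eq_one {p q : ℝ} (h : NonnegCol p q) (hq : q = 1) :
    ∃ k : ℤ, p = k * lam := by
  have hl := lam_gt
  induction h with
  | left => norm_num at hq
  | right => exact ⟨0, by simp⟩
  | one h ih =>
    obtain ⟨k, rfl⟩ := ih hq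
    exact ⟨k + 1, by rw [hq]; push_cast; ring⟩
  | two h ih =>
    rcases h.gap with ⟨rfl, rfl⟩ | ⟨rfl, rfl⟩ | ⟨h1, h2⟩
    · linarith
    · exact ⟨1, by simp⟩
    · nlinarith
  | three h ih => rcases h.gap with ⟨rfl, rfl⟩ | ⟨rfl, rfl⟩ | ⟨h1, h2⟩ <;> nlinarith
  | four h ih =>
    rcases h.gap with ⟨rfl, rfl⟩ | ⟨rfl, rfl⟩ | ⟨h1, h2⟩
    · exact ⟨0, by simp⟩
    · linarith
    · nlinarith

lemma NonnegCol.of_snd_eq_lam {p q : ℝ} (h : NonnegCol p q) (hq : q = lam) :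
    ∃ k : ℤ, p = k * lam ^ 2 + 1 ∨ p = k * lam ^ 2 - 1 := by
  have hl := lam_gt
  have hl' := lam_lt
  have hs := lam_sq
  induction h with
  | left => linarith
  | right => linarith
  | one h ih =>
    obtain ⟨k, h | h⟩ := ih hq
    · exact ⟨k + 1, Or.inl (by rw [hq, h]; push_cast; ring)⟩
    · exact ⟨k + 1, Or.inr (by rw [hq, h]; push_cast; ring)⟩
  | two h ih =>
    rcases h.gap with ⟨rfl, rfl⟩ | ⟨rfl, rfl⟩ | ⟨h1, h2⟩
    · exact ⟨1, Or.inr (by push_cast; linarith)⟩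
    · linarith
    · nlinarith
  | three h ih =>
    rcases h.gap with ⟨rfl, rfl⟩ | ⟨rfl, rfl⟩ | ⟨h1, h2⟩
    · exact ⟨0, Or.inl (by simp)⟩
    · exact ⟨1, Or.inr (by push_cast; linarith)⟩
    · nlinarith
  | four h ih =>
    rcases h.gap with ⟨rfl, rfl⟩ | ⟨rfl, rfl⟩ | ⟨h1, h2⟩
    · linarith
    · exact ⟨0, Or.inl (by simp)⟩
    · nlinarith

lemma NonnegCol.form {p q : ℝ} (h : NonnegCol p q) :
    ∃ P Q K : ZLam, (P : ℝ) = p ∧ (Q : ℝ) = q ∧ P ^ 2 + gen * P * Q + Q ^ 2 = 1 + 2 * K := by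
  have hs := gen_sq
  have hg : (gen : ℝ) = lam := rfl
  induction h with
  | left => exact ⟨1, 0, 0, by simp⟩
  | right => exact ⟨0, 1, 0, by simp⟩
  | @one p q h ih =>
    obtain ⟨P, Q, K, rfl, rfl, e⟩ := ih
    exact ⟨P + gen * Q, Q, K + gen * P * Q + gen ^ 2 * Q ^ 2, by simp [hg], rfl, by
      linear_combination e⟩
  | @two p q h ih =>
    obtain ⟨P, Q, K, rfl, rfl, e⟩ := ih
    exact ⟨gen * (P + Q), P + gen * Q,
      K + (gen + 1) * P ^ 2 + (3 * gen + 2) * P * Q + (2 * gen + 1) * Q ^ 2,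
      by simp [hg], by simp [hg], by
      linear_combination e + (2 * P ^ 2 + (gen + 4) * P * Q + (gen + 3) * Q ^ 2) * hs⟩
  | @three p q h ih =>
    obtain ⟨P, Q, K, rfl, rfl, e⟩ := ih
    exact ⟨gen * P + Q, gen * (P + Q),
      K + (gen + 1) * Q ^ 2 + (3 * gen + 2) * P * Q + (2 * gen + 1) * P ^ 2,
      by simp [hg], by simp [hg], by
      linear_combination e + (2 * Q ^ 2 + (gen + 4) * P * Q + (gen + 3) * P ^ 2) * hs⟩
  | @four p q h ih =>
    obtain ⟨P, Q, K, rfl, rfl, e⟩ := ih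
    exact ⟨P, gen * P + Q, K + gen * P * Q + gen ^ 2 * P ^ 2, rfl, by simp [hg], by
      linear_combination e⟩

/-! ### Every element of `ℚ(√5)` is a cusp -/

/-- The constant 1.31 bounds λ²/2, as c will be λb with |b| ≤ (λ/2)|a|. If |k| ≥ 2, then 4|r| ≤ 2|c|
≤ |a| + |r|; the other values of k are compared directly. -/
lemma abs_le_third {a c r : ℝ} {k : ℤ} (hr : r = a - k * c) (hc : |c| ≤ 1.31 * |a|)
    (h : |r| ≤ |c| / 2) : |r| ≤ |a| / 3 := by
  by_cases hk : 2 ≤ |k|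
  · have hk' : (2 : ℝ) ≤ |(k : ℝ)| := by exact_mod_cast hk
    have h1 : |(k : ℝ)| * |c| ≤ |a| + |r| := by
      rw [← abs_mul, show (k : ℝ) * c = a - r by rw [hr]; ring]; exact abs_sub _ _
    have h2 : 2 * |c| ≤ |(k : ℝ)| * |c| := by gcongr
    linarith
  · have : k = 0 ∨ k = 1 ∨ k = -1 := by
      rw [not_le, abs_lt] at hk; omega
    rcases this with rfl | rfl | rfl <;> push_cast at hr <;>
    rcases abs_cases a with ⟨h1, _⟩ | ⟨h1, _⟩ <;> rcases abs_cases c with ⟨h2, _⟩ | ⟨h2, _⟩ <;>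
    rcases abs_cases r with ⟨h3, _⟩ | ⟨h3, _⟩ <;> rw [h1, h2] at hc <;> rw [h2, h3] at h <;>
    rw [h1, h3] <;> linarith

lemma exists_remainder (a b : ℝ) (hb : b ≠ 0) : ∃ k : ℤ, |a - k * (lam * b)| ≤ |lam * b| / 2 := by
  have hc : lam * b ≠ 0 := mul_ne_zero lam_pos.ne' hb
  refine ⟨round (a / (lam * b)), ?_⟩
  have := abs_sub_round (a / (lam * b))
  have e : a - round (a / (lam * b)) * (lam * b) =
      (a / (lam * b) - round (a / (lam * b))) * (lam * b) := by
    rw [sub_mul, div_mul_cancel₀ _ hc]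
  rw [e, abs_mul]
  nlinarith [abs_nonneg (lam * b)]

/-- One division step, on the level of matrices. -/
lemma exists_kill_of_step {a b : ℝ} (k : ℤ)
    (h : ∃ A ∈ SLG5, A 1 0 * -b + A 1 1 * (a - k * (lam * b)) = 0) :
    ∃ A ∈ SLG5, A 1 0 * a + A 1 1 * b = 0 := by
  obtain ⟨A, hA, h⟩ := h
  refine ⟨A * (matS * upper ((-k : ℤ) * lam)),
    SLG5.mul_mem hA (SLG5.mul_mem matS_mem (upper_lam_mem _)), ?_⟩
  simp only [mul_entry]
  simp [matS, upper]
  linear_combination h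

/-- A Euclidean algorithm with steps (a, b) ↦ (−b, a − kλb). With primes for Galois conjugates, the
potential |a||b'| + 1.2|b||a'| shrinks by a factor 0.92, since its new value is at most |b||a'| +
(0.51 + 1.2/3)|a||b'|. Once it is below 1, so is the absolute norm of b, and b = 0. -/
lemma exists_kill_of_potential_lt (n : ℕ) : ∀ a₀ a₁ b₀ b₁ : ℤ,
    |(b₀ + b₁ * lam)| ≤ lam / 2 * |(a₀ + a₁ * lam)| →
    |(a₀ + a₁ * lam)| * |conj b₀ b₁| + 1.2 * (|(b₀ + b₁ * lam)| * |conj a₀ a₁|) < (1 / 0.92) ^ n →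
    ∃ A ∈ SLG5, A 1 0 * (a₀ + a₁ * lam) + A 1 1 * (b₀ + b₁ * lam) = 0 := by
  have hl := lam_gt
  have hl' := lam_lt
  have hs := lam_sq
  induction n with
  | zero =>
    intro a₀ a₁ b₀ b₁ hab h
    have h1 : |(b₀ + b₁ * lam) * conj b₀ b₁| < 1 := by
      rw [abs_mul]
      have : |(b₀ + b₁ * lam)| * |conj b₀ b₁| ≤ lam / 2 * |(a₀ + a₁ * lam)| * |conj b₀ b₁| := by
        gcongr
      have p1 : 0 ≤ |(a₀ + a₁ * lam)| * |conj b₀ b₁| := by positivity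
      have p2 : 0 ≤ |(b₀ + b₁ * lam)| * |conj a₀ a₁| := by positivity
      rw [pow_zero] at h
      nlinarith
    obtain ⟨rfl, rfl⟩ := eq_zero_of_abs_norm_lt_one h1
    exact ⟨1, SLG5.one_mem, by simp⟩
  | succ n ih =>
    intro a₀ a₁ b₀ b₁ hab h
    by_cases hb : (b₀ + b₁ * lam : ℝ) = 0
    · exact ⟨1, SLG5.one_mem, by simp [hb]⟩
    obtain ⟨k, hk⟩ := exists_remainder (a₀ + a₁ * lam) (b₀ + b₁ * lam) hb
    have er : ((a₀ - k * b₁ : ℤ) : ℝ) + ((a₁ - k * (b₀ + b₁) : ℤ) : ℝ) * lam =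
        (a₀ + a₁ * lam) - k * (lam * (b₀ + b₁ * lam)) := by
      push_cast; linear_combination (k : ℝ) * b₁ * hs
    have ec : conj (a₀ - k * b₁) (a₁ - k * (b₀ + b₁)) =
        conj a₀ a₁ - k * ((1 - lam) * conj b₀ b₁) := by
      simp only [conj]; push_cast; linear_combination (k : ℝ) * b₁ * hs
    have en : ((-b₀ : ℤ) : ℝ) + ((-b₁ : ℤ) : ℝ) * lam = -(b₀ + b₁ * lam) := by push_cast; ring
    have en' : conj (-b₀) (-b₁) = -conj b₀ b₁ := by simp only [conj]; push_cast; ring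
    have := ih (-b₀) (-b₁) (a₀ - k * b₁) (a₁ - k * (b₀ + b₁))
    rw [er, ec, en, en', abs_neg, abs_neg] at this
    refine exists_kill_of_step k (this ?_ ?_)
    · rw [abs_mul, abs_of_pos lam_pos] at hk; linarith
    generalize (a₀ + a₁ * lam : ℝ) = a at *
    generalize (b₀ + b₁ * lam : ℝ) = b at *
    generalize conj a₀ a₁ = a' at *
    generalize conj b₀ b₁ = b' at *
    have hr : |a - k * (lam * b)| ≤ |a| / 3 := by
      refine abs_le_third rfl ?_ hk
      rw [abs_mul, abs_of_pos lam_pos]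
      nlinarith [abs_nonneg a, abs_nonneg b]
    have hkb : |(k : ℝ)| * (lam * |b|) ≤ 4 / 3 * |a| := by
      have : |(k : ℝ) * (lam * b)| ≤ |a| + |a - k * (lam * b)| := by
        have := abs_sub a (a - k * (lam * b))
        rwa [sub_sub_cancel] at this
      rw [abs_mul, abs_mul, abs_of_pos lam_pos] at this
      linarith
    -- Here λ − 1 is the size of the conjugate of λ; it equals λ(2 − λ), and (4/3)(2 − λ) < 0.51.
    have hkb' : |(k : ℝ)| * |b| * (lam - 1) ≤ 0.51 * |a| := by
      have e : |(k : ℝ)| * |b| * (lam - 1) = |(k : ℝ)| * (lam * |b|) * (2 - lam) := by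
        linear_combination |(k : ℝ)| * |b| * hs
      rw [e]
      nlinarith [abs_nonneg a]
    have h1 : |b| * |a' - k * ((1 - lam) * b')| ≤ |b| * |a'| + 0.51 * (|a| * |b'|) := by
      have : |a' - k * ((1 - lam) * b')| ≤ |a'| + |(k : ℝ)| * ((lam - 1) * |b'|) := by
        refine (abs_sub _ _).trans ?_
        rw [abs_mul, abs_mul, abs_of_neg (by linarith : 1 - lam < 0), neg_sub]
      calc _ ≤ |b| * (|a'| + |(k : ℝ)| * ((lam - 1) * |b'|)) := by gcongr
        _ = |b| * |a'| + |(k : ℝ)| * |b| * (lam - 1) * |b'| := by ring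
        _ ≤ |b| * |a'| + 0.51 * |a| * |b'| := by gcongr
        _ = _ := by ring
    have h2 : |a - k * (lam * b)| * |b'| ≤ 1 / 3 * (|a| * |b'|) := by
      calc _ ≤ |a| / 3 * |b'| := by gcongr
        _ = _ := by ring
    have p2 : 0 ≤ |b| * |a'| := by positivity
    have p1 : 0 ≤ |a| * |b'| := by positivity
    rw [pow_succ] at h
    linarith

/-- Every vector over `ℤ[λ]` is a multiple of a column of an element of the Hecke group. -/
lemma exists_isCol {a b : ℝ} (ha : a ∈ ZLam) (hb : b ∈ ZLam) :
    ∃ p q d : ℝ, IsCol p q ∧ d ∈ ZLam ∧ a = d * p ∧ b = d * q := by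
  obtain ⟨A, hA, h⟩ : ∃ A ∈ SLG5, A 1 0 * a + A 1 1 * b = 0 := by
    by_cases h0 : b = 0
    · exact ⟨1, SLG5.one_mem, by simp [h0]⟩
    -- One division step puts an arbitrary pair into the size range that the algorithm requires.
    obtain ⟨k, hk⟩ := exists_remainder a b h0
    refine exists_kill_of_step k ?_
    have hr : a - k * (lam * b) ∈ ZLam :=
      ZLam.sub_mem ha (ZLam.mul_mem (int_mem k) (ZLam.mul_mem lam_mem hb))
    obtain ⟨r₀, r₁, er⟩ := mem_ZLam_iff.1 hr
    obtain ⟨b₀, b₁, eb⟩ := mem_ZLam_iff.1 (ZLam.neg_mem hb)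
    obtain ⟨n, hn⟩ := pow_unbounded_of_one_lt (|(b₀ + b₁ * lam)| * |conj r₀ r₁| +
      1.2 * (|(r₀ + r₁ * lam)| * |conj b₀ b₁|)) (by norm_num : (1 : ℝ) < 1 / 0.92)
    have := exists_kill_of_potential_lt n b₀ b₁ r₀ r₁ ?_ hn
    · rwa [← er, ← eb] at this
    · rw [← er, ← eb, abs_neg]
      rw [abs_mul, abs_of_pos lam_pos] at hk
      linarith
  have hAi := SLG5.inv_mem hA
  obtain ⟨e1, e2, e3, e4⟩ := inv_entries A
  refine ⟨A⁻¹ 0 0, A⁻¹ 1 0, A 0 0 * a + A 0 1 * b, .of_first hAi,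
    ZLam.add_mem (ZLam.mul_mem (entry_mem hA _ _) ha) (ZLam.mul_mem (entry_mem hA _ _) hb), ?_, ?_⟩
  · rw [e1]; linear_combination -a * det_eq A - A 0 1 * h
  · rw [e3]; linear_combination -b * det_eq A + A 0 0 * h

/-! ### Columns with second entry 0, 1 or λ -/

lemma IsCol.of_snd_eq_one {p q : ℝ} (h : IsCol p q) (hq : |q| = 1) : ∃ k : ℤ, p = k * lam := by
  obtain ⟨k, hk⟩ := h.nonnegCol.of_snd_eq_one hq
  rcases abs_choice p with e | e
  · exact ⟨k, by rw [← e, hk]⟩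
  · exact ⟨-k, by rw [e] at hk; push_cast; linarith⟩

lemma IsCol.abs_fst_of_snd_eq_zero {p q : ℝ} (h : IsCol p q) (hq : q = 0) : |p| = 1 := by
  have := h.nonnegCol.gap
  simp only [hq, abs_zero] at this
  norm_num at this
  exact this

/-- Since kλ² ± 1 = kλ + (k ± 1), such a number is an integer only for k = 0. -/
lemma IsCol.abs_int_of_snd_eq_lam {s : ℤ} (h : IsCol s lam) : |s| = 1 := by
  obtain ⟨k, hk⟩ := h.nonnegCol.of_snd_eq_lam (abs_of_pos lam_pos)
  rw [lam_sq, ← Int.cast_abs] at hk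
  rcases hk with hk | hk
  · have := int_add_mul_lam_inj (a := |s|) (b := 0) (c := k + 1) (d := k)
      (by rw [hk]; push_cast; ring)
    omega
  · have := int_add_mul_lam_inj (a := |s|) (b := 0) (c := k - 1) (d := k)
      (by rw [hk]; push_cast; ring)
    have := abs_nonneg s
    omega

lemma IsCol.lower {p q : ℝ} (h : IsCol p q) (k : ℤ) : IsCol p (q + k * lam * p) := by
  have := h.smul (lower_lam_mem k)
  simp only [HeckeFive.lower, of_apply, cons_val', cons_val_zero, cons_val_one,
    cons_val_fin_one] at this
  convert this using 1 <;> ring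

lemma IsCol.of_neg_or {p q f : ℝ} (hf : f = 1 ∨ f = -1) (h : IsCol (f * p) (f * q)) :
    IsCol p q := by
  rcases hf with rfl | rfl
  · simpa using h
  · simpa using h.neg

/-! ### `ℤ[λ]` is a principal ideal domain -/

/-- The vector (a, b) is d times a column and columns are unimodular, so d generates the ideal (a,
b). -/
instance : IsBezout ZLam := by
  rw [IsBezout.iff_span_pair_isPrincipal]
  intro a b
  obtain ⟨p, q, d, h, hd, ea, eb⟩ := exists_isCol a.2 b.2
  obtain ⟨x, hx, y, hy, hxy⟩ := h.bezout
  obtain ⟨hp, hq⟩ := h.mem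
  refine ⟨⟨⟨d, hd⟩, ?_⟩⟩
  apply le_antisymm
  · rw [Ideal.span_le]
    rintro z (rfl | rfl)
    · exact Ideal.mem_span_singleton'.2 ⟨⟨p, hp⟩, Subtype.ext (by rw [ea]; push_cast; ring)⟩
    · exact Ideal.mem_span_singleton'.2 ⟨⟨q, hq⟩, Subtype.ext (by rw [eb]; push_cast; ring)⟩
  · refine Ideal.span_le.2 (Set.singleton_subset_iff.2 ?_)
    refine Ideal.mem_span_pair.2 ⟨⟨x, hx⟩, ⟨y, hy⟩, Subtype.ext ?_⟩
    push_cast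
    rw [ea, eb]
    linear_combination d * hxy

instance : IsNoetherianRing ZLam := by
  have : Algebra.FiniteType ℤ ZLam :=
    (Subalgebra.fg_iff_finiteType _).1 ⟨{lam}, by simp⟩
  exact Algebra.FiniteType.isNoetherianRing ℤ ZLam

/-- In a principal ideal domain, a primitive triple `(a, b, c)` with `c ≠ 0` admits `x` such that
`a x + b` is coprime to `c`. -/
lemma exists_isCoprime_mul_add {R : Type*} [CommRing R] [IsDomain R] [IsPrincipalIdealRing R]
    (a b c : R) (hc : c ≠ 0) (h : ∀ p : R, Prime p → p ∣ a → p ∣ b → p ∣ c → False) :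
    ∃ x, IsCoprime (a * x + b) c := by
  induction c using UniqueFactorizationMonoid.induction_on_prime with
  | h₁ => exact absurd rfl hc
  | h₂ u hu =>
    obtain ⟨u, rfl⟩ := hu
    exact ⟨0, 0, ↑u⁻¹, by simp⟩
  | h₃ c p hc0 hp ih =>
    obtain ⟨x, hx⟩ := ih hc0 fun q hq h1 h2 h3 => h q hq h1 h2 (h3.mul_left p)
    by_cases hd : p ∣ a * x + b
    · refine ⟨x + c, ?_⟩
      have e : a * (x + c) + b = a * x + b + a * c := by ring
      rw [e]
      refine IsCoprime.mul_right (isCoprime_comm.1 ?_) ?_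
      · rw [hp.irreducible.coprime_iff_not_dvd, dvd_add_right hd]
        intro hac
        rcases hp.dvd_or_dvd hac with h1 | h1
        · exact h p hp h1 ((dvd_add_right (h1.mul_right x)).1 hd) (dvd_mul_right p c)
        · exact hp.not_isUnit (hx.isUnit_of_dvd' hd h1)
      · exact IsCoprime.add_mul_right_left hx a
    · exact ⟨x, IsCoprime.mul_right (isCoprime_comm.1 (hp.irreducible.coprime_iff_not_dvd.2 hd)) hx⟩

/-! ### Matrices that permute the columns up to square roots of rational numbers -/

/-- `f` is a unit of `ℤ[λ]`. -/
def IsUnitZLam (f : ℝ) : Prop := f ∈ ZLam ∧ ∃ g ∈ ZLam, f * g = 1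

lemma IsUnitZLam.mul {f g : ℝ} (hf : IsUnitZLam f) (hg : IsUnitZLam g) : IsUnitZLam (f * g) := by
  obtain ⟨hf, f', hf', e⟩ := hf
  obtain ⟨hg, g', hg', e'⟩ := hg
  exact ⟨ZLam.mul_mem hf hg, f' * g', ZLam.mul_mem hf' hg', by
    linear_combination g * g' * e + e'⟩

lemma IsCol.isUnitZLam {p q a b f : ℝ} (h : IsCol p q) (ha : a ∈ ZLam) (hb : b ∈ ZLam)
    (hab : ∃ x ∈ ZLam, ∃ y ∈ ZLam, x * a + y * b = 1) (hp : p = f * a) (hq : q = f * b) :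
    IsUnitZLam f := by
  obtain ⟨x, hx, y, hy, e⟩ := hab
  obtain ⟨x', hx', y', hy', e'⟩ := h.bezout
  obtain ⟨hpm, hqm⟩ := h.mem
  refine ⟨?_, x' * a + y' * b, ZLam.add_mem (ZLam.mul_mem hx' ha) (ZLam.mul_mem hy' hb), ?_⟩
  · have : f = x * p + y * q := by rw [hp, hq]; linear_combination -f * e
    rw [this]
    exact ZLam.add_mem (ZLam.mul_mem hx hpm) (ZLam.mul_mem hy hqm)
  · rw [hp, hq] at e'; linear_combination e'

/-- The matrix `g` maps every column to a multiple of a column, where the squares of the factors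
are rational. -/
def PermutesCols (g : Matrix.SpecialLinearGroup (Fin 2) ℝ) : Prop :=
  ∀ p q, IsCol p q → ∃ p' q' ν : ℝ, IsCol p' q' ∧ ν ≠ 0 ∧ (∃ r : ℚ, ν ^ 2 = r) ∧
    g 0 0 * p + g 0 1 * q = ν * p' ∧ g 1 0 * p + g 1 1 * q = ν * q'

lemma PermutesCols.mul_left {g A : Matrix.SpecialLinearGroup (Fin 2) ℝ} (hg : PermutesCols g)
    (hA : A ∈ SLG5) : PermutesCols (A * g) := by
  intro p q h
  obtain ⟨p', q', ν, h', hν, hr, e1, e2⟩ := hg p q h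
  refine ⟨_, _, ν, h'.smul hA, hν, hr, ?_, ?_⟩ <;> simp only [mul_entry]
  · linear_combination A 0 0 * e1 + A 0 1 * e2
  · linear_combination A 1 0 * e1 + A 1 1 * e2

lemma PermutesCols.mul_right {g A : Matrix.SpecialLinearGroup (Fin 2) ℝ} (hg : PermutesCols g)
    (hA : A ∈ SLG5) : PermutesCols (g * A) := by
  intro p q h
  obtain ⟨p', q', ν, h', hν, hr, e1, e2⟩ := hg _ _ (h.smul hA)
  refine ⟨_, _, ν, h', hν, hr, ?_, ?_⟩ <;> simp only [mul_entry]
  · linear_combination e1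
  · linear_combination e2

lemma PermutesCols.sq_rat_of_upper {g : Matrix.SpecialLinearGroup (Fin 2) ℝ} (hg : PermutesCols g)
    (h : g 1 0 = 0) : ∃ r : ℚ, g 0 0 ^ 2 = r := by
  obtain ⟨p', q', ν, h', hν, ⟨r, hr⟩, e1, e2⟩ := hg _ _ .one_zero
  rw [h] at e2
  have hq : q' = 0 := by simpa [hν] using e2.symm
  refine ⟨r, ?_⟩
  have := h'.abs_fst_of_snd_eq_zero hq
  have hp : p' ^ 2 = 1 := by rw [← sq_abs, this, one_pow]
  have : g 0 0 = ν * p' := by simpa using e1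
  rw [this, mul_pow, hp, mul_one, hr]

lemma lam_mul_sub_one : lam * (lam - 1) = 1 := by linear_combination lam_sq

/-- Write μ² = s/t in lowest terms with us + vt = 1. The column (1, vλ) goes to a multiple of the
unimodular vector (s, vtλ), which is a column up to a unit with rational square, that is, up to
sign. Adding uλs to its second entry gives the column (s, λ), so |s| = 1. Starting from (uλ, 1)
gives |t| = 1. -/
lemma PermutesCols.sq_eq_one_of_diag {g : Matrix.SpecialLinearGroup (Fin 2) ℝ}
    (hg : PermutesCols g) (h10 : g 1 0 = 0) (h01 : g 0 1 = 0) : g 0 0 ^ 2 = 1 := by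
  obtain ⟨r, hr⟩ := hg.sq_rat_of_upper h10
  have hdet := det_eq g
  rw [h10, mul_zero, sub_zero] at hdet
  set μ := g 0 0 with hμdef
  have hμ : μ ≠ 0 := left_ne_zero_of_mul_eq_one hdet
  have ht : (r.den : ℝ) ≠ 0 := by exact_mod_cast r.den_ne_zero
  have hst : (r.num : ℝ) = r.den * μ ^ 2 := by
    rw [hr]; exact_mod_cast (Rat.den_mul_eq_num r).symm
  have hs : (r.num : ℝ) ≠ 0 := by rw [hst]; positivity
  have hcop : IsCoprime r.num (r.den : ℤ) := Int.isCoprime_iff_gcd_eq_one.2 r.reduced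
  obtain ⟨u, v, huv⟩ := hcop
  have huv' : (u : ℝ) * r.num + v * r.den = 1 := by exact_mod_cast huv
  have hf : ∀ ν : ℝ, (∃ r : ℚ, ν ^ 2 = r) → ∃ r' : ℚ, (μ / (ν * r.num)) ^ 2 = r' := by
    rintro ν ⟨r', hr'⟩
    refine ⟨r / (r' * r.num ^ 2), ?_⟩
    push_cast
    rw [← hr, ← hr', div_pow, mul_pow]
  have h1 : |r.num| = 1 := by
    apply IsCol.abs_int_of_snd_eq_lam
    have hc : IsCol 1 (v * lam) := by simpa using IsCol.one_zero.lower v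
    obtain ⟨p', q', ν, h', hν, hrat, e1, e2⟩ := hg _ _ hc
    rw [h01] at e1
    rw [h10] at e2
    have e1' : p' = μ / (ν * r.num) * r.num := by
      field_simp; linear_combination -e1
    have e2' : q' = μ / (ν * r.num) * (v * r.den * lam) := by
      have : r.num * (ν * q') = v * r.den * lam * μ := by
        rw [← e2, hst]; linear_combination (r.den : ℝ) * μ * v * lam * hdet
      field_simp; linear_combination this
    obtain ⟨m1, f', m2, e⟩ := h'.isUnitZLam (int_mem _) (ZLam.mul_mem (ZLam.mul_mem (int_mem v)
      (by exact_mod_cast int_mem r.den)) lam_mem) ⟨u, int_mem u, lam - 1,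
        ZLam.sub_mem lam_mem ZLam.one_mem, by
          linear_combination huv' + (v : ℝ) * r.den * lam_mul_sub_one⟩ e1' e2'
    obtain ⟨r', hr'⟩ := hf ν hrat
    rw [e1', e2'] at h'
    have := (h'.of_neg_or (eq_one_or_neg_one_of_sq_rat m1 m2 e hr')).lower u
    convert this using 1
    linear_combination -lam * huv'
  have h2 : |-(r.den : ℤ)| = 1 := by
    apply IsCol.abs_int_of_snd_eq_lam
    have hc : IsCol (u * lam) 1 := by
      simpa using ((IsCol.one_zero.swap).shift u)
    obtain ⟨p', q', ν, h', hν, hrat, e1, e2⟩ := hg _ _ hc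
    rw [h01] at e1
    rw [h10] at e2
    have e1' : p' = μ / (ν * r.num) * (u * r.num * lam) := by
      field_simp; linear_combination -e1
    have e2' : q' = μ / (ν * r.num) * r.den := by
      have : r.num * (ν * q') = r.den * μ := by
        rw [← e2, hst]; linear_combination (r.den : ℝ) * μ * hdet
      field_simp; linear_combination this
    obtain ⟨m1, f', m2, e⟩ := h'.isUnitZLam (ZLam.mul_mem (ZLam.mul_mem (int_mem u)
      (int_mem _)) lam_mem) (by exact_mod_cast int_mem r.den) ⟨lam - 1,
        ZLam.sub_mem lam_mem ZLam.one_mem, v, int_mem v, by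
          linear_combination huv' + (u : ℝ) * r.num * lam_mul_sub_one⟩ e1' e2'
    obtain ⟨r', hr'⟩ := hf ν hrat
    rw [e1', e2'] at h'
    have := ((h'.of_neg_or (eq_one_or_neg_one_of_sq_rat m1 m2 e hr')).shift v).swap
    convert this using 1
    · simp
    · linear_combination -lam * huv'
  have hden : (r.den : ℝ) = 1 := by
    have : r.den = 1 := by simpa [abs_neg] using h2
    exact_mod_cast this
  rw [hden, one_mul] at hst
  rcases (abs_eq zero_le_one).1 h1 with h | h <;> rw [h] at hst
  · rw [← hst]; simp
  · have := sq_nonneg μ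
    rw [← hst] at this; norm_num at this

lemma upper_entries (x : ℝ) :
    upper x 0 0 = 1 ∧ upper x 0 1 = x ∧ upper x 1 0 = 0 ∧ upper x 1 1 = 1 := by
  simp [upper]

lemma PermutesCols.exists_upper {g : Matrix.SpecialLinearGroup (Fin 2) ℝ} (hg : PermutesCols g) :
    ∃ B ∈ SLG5, (B * g) 1 0 = 0 := by
  obtain ⟨p', q', ν, ⟨B, hB, rfl, rfl⟩, hν, hr, e1, e2⟩ := hg _ _ .one_zero
  refine ⟨B⁻¹, SLG5.inv_mem hB, ?_⟩
  obtain ⟨i1, i2, i3, i4⟩ := inv_entries B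
  rw [mul_entry, i3, i4]
  linear_combination B 0 0 * e2 - B 1 0 * e1

/-- An upper triangular matrix that permutes the columns and whose second column is, up to a
factor, a unimodular vector over `ℤ[λ]` with a unit as its second entry, is in the Hecke group. -/
lemma PermutesCols.mem_of_upper {g : Matrix.SpecialLinearGroup (Fin 2) ℝ} (hg : PermutesCols g)
    (h10 : g 1 0 = 0) {κ y₂ y₃ : ℝ} (hy₂ : y₂ ∈ ZLam) (hy₃ : IsUnitZLam y₃) (h01 : g 0 1 = κ * y₂)
    (h11 : g 1 1 = κ * y₃) : g ∈ SLG5 := by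
  obtain ⟨r, hr⟩ := hg.sq_rat_of_upper h10
  have hdet := det_eq g
  rw [h10, mul_zero, sub_zero] at hdet
  have hμ : g 0 0 ≠ 0 := left_ne_zero_of_mul_eq_one hdet
  obtain ⟨p, q, ν, hpq, hν, ⟨r', hr'⟩, e1, e2⟩ := hg 0 1 (by simpa using IsCol.one_zero.swap)
  rw [mul_zero, zero_add, mul_one] at e1 e2
  have hF : IsUnitZLam (κ / ν) := by
    obtain ⟨hy, y', hy', e⟩ := hy₃
    refine hpq.isUnitZLam hy₂ hy ⟨0, ZLam.zero_mem, y', hy', by linear_combination e⟩ ?_ ?_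
    · field_simp; linear_combination h01 - e1
    · field_simp; linear_combination h11 - e2
  have hq : q = κ / ν * y₃ := by field_simp; linear_combination h11 - e2
  obtain ⟨m1, f', m2, e⟩ := hF.mul hy₃
  rw [← hq] at m1 e
  -- The determinant gives (g 0 0) · νq = 1, and the squares of g 0 0 and ν are rational, so q² is
  -- rational too.
  have hq1 := eq_one_or_neg_one_of_sq_rat m1 m2 e (r := (r * r')⁻¹) (by
    push_cast
    rw [← hr, ← hr', ← mul_pow]
    refine eq_inv_of_mul_eq_one_left ?_
    have : g 0 0 * (ν * q) = 1 := by rw [← e2]; exact hdet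
    linear_combination (g 0 0 * (ν * q) + 1) * this)
  obtain ⟨k, hk⟩ := hpq.of_snd_eq_one (by rcases hq1 with h | h <;> simp [h])
  obtain ⟨k', hk'⟩ : ∃ k' : ℤ, (k' : ℝ) * lam * q = -p := by
    rcases hq1 with h | h
    · exact ⟨-k, by rw [h, hk]; push_cast; ring⟩
    · exact ⟨k, by rw [h, hk]; ring⟩
  have hU := upper_lam_mem k'
  set g' := upper (k' * lam) * g with hg'
  obtain ⟨u1, u2, u3, u4⟩ := upper_entries (k' * lam)
  have h10' : g' 1 0 = 0 := by rw [hg', mul_entry, u3, u4, h10]; ring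
  have h00' : g' 0 0 = g 0 0 := by rw [hg', mul_entry, u1, h10]; ring
  have h11' : g' 1 1 = g 1 1 := by rw [hg', mul_entry, u3, u4]; ring
  have h01' : g' 0 1 = 0 := by
    rw [hg', mul_entry, u1, u2, e1, e2]; linear_combination ν * hk'
  have hsq := (hg.mul_left hU).sq_eq_one_of_diag h10' h01'
  rw [h00'] at hsq
  have hmem : g' ∈ SLG5 := by
    rcases mul_self_eq_one_iff.1 ((sq _).symm.trans hsq) with h | h
    · have : g' = 1 := by
        rw [h, one_mul] at hdet
        ext i j
        fin_cases i <;> fin_cases j <;> simp [h10', h00', h11', h01', h, hdet]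
      rw [this]; exact SLG5.one_mem
    · have : g' = -1 := by
        rw [h] at hdet
        have hd : g 1 1 = -1 := by linarith
        ext i j
        fin_cases i <;> fin_cases j <;> simp [h10', h00', h11', h01', h, hd]
      rw [this]; exact neg_mem_SLG5 SLG5.one_mem
  rw [hg'] at hmem
  exact (Subgroup.mul_mem_cancel_left _ hU).1 hmem

/-- The aim is to reach the situation of `mem_of_upper` by multiplying with elements of G₅ on both
sides. For g with rows (μ, νp) and (0, νq), the image of a third cusp gives μ : ν = ρ₁ : ρ₂ with ρ₁,
ρ₂ coprime in ℤ[λ]. Then g maps (ρ₂(qx − p), ρ₁) to νqρ₁ · (x, 1), and x is chosen to make the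
source unimodular. -/
lemma PermutesCols.mem {g : Matrix.SpecialLinearGroup (Fin 2) ℝ} (hg : PermutesCols g) :
    g ∈ SLG5 := by
  wlog h10 : g 1 0 = 0 generalizing g with H
  · obtain ⟨B, hB, h⟩ := hg.exists_upper
    exact (Subgroup.mul_mem_cancel_left _ hB).1 (H (hg.mul_left hB) h)
  have hl := lam_pos
  have hdet := det_eq g
  rw [h10, mul_zero, sub_zero] at hdet
  obtain ⟨p, q, ν, hpq, hν, -, e1, e2⟩ := hg 0 1 (by simpa using IsCol.one_zero.swap)
  rw [mul_zero, zero_add, mul_one] at e1 e2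
  -- This column represents the cusp 1, which besides ∞ and 0 is what fixes the ratio μ/ν.
  have hll : IsCol lam lam := by
    convert ((IsCol.one_zero.swap.shift 1).lower (-1)).swap using 1 <;> push_cast
    · linear_combination -lam_sq
    · ring
  obtain ⟨p₃, q₃, κ, h₃, hκ, -, e3, e4⟩ := hg _ _ hll
  rw [h10, e2] at e4
  rw [e1] at e3
  set μ := g 0 0 with hμdef
  have hμ : μ ≠ 0 := left_ne_zero_of_mul_eq_one hdet
  obtain ⟨hp, hq⟩ := hpq.mem
  obtain ⟨hp₃, hq₃⟩ := h₃.mem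
  have hq0 : q ≠ 0 := by
    rintro rfl
    rw [e2] at hdet; simp at hdet
  have hq₃0 : q₃ ≠ 0 := by
    rintro rfl
    have : ν * q * lam = 0 := by linear_combination e4
    simp [hν, hq0, hl.ne'] at this
  have hratio : μ * q₃ = ν * (q * p₃ - p * q₃) := by
    have : κ * (μ * q₃) = κ * (ν * (q * p₃ - p * q₃)) := by
      have h1 : lam * (μ * q₃) = lam * (ν * (q * p₃ - p * q₃)) := by
        have h2 : κ * (lam * (μ * q₃)) = κ * (lam * (ν * (q * p₃ - p * q₃))) := by
          linear_combination κ * q₃ * e3 - κ * p₃ * e4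
        exact mul_left_cancel₀ hκ h2
      rw [mul_left_cancel₀ hl.ne' h1]
    exact mul_left_cancel₀ hκ this
  obtain ⟨ρ₁, ρ₂, d₀, hρ, hd₀, er1, er2⟩ := exists_isCol
    (ZLam.sub_mem (ZLam.mul_mem hq hp₃) (ZLam.mul_mem hp hq₃)) hq₃
  have hd₀0 : d₀ ≠ 0 := by rintro rfl; exact hq₃0 (by rw [er2, zero_mul])
  have hμν : ρ₂ * μ = ρ₁ * ν := by
    rw [er1, er2] at hratio
    exact mul_left_cancel₀ hd₀0 (by linear_combination hratio)
  have hρ₂0 : ρ₂ ≠ 0 := by rintro rfl; exact hq₃0 (by rw [er2, mul_zero])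
  have hρ₁0 : ρ₁ ≠ 0 := by
    rintro rfl
    rw [zero_mul] at hμν
    exact (mul_ne_zero hρ₂0 hμ) hμν
  obtain ⟨hρ₁, hρ₂⟩ := hρ.mem
  -- a vector that `g` maps to a multiple of `(x, 1)`
  obtain ⟨x, u, w, huw⟩ := exists_isCoprime_mul_add (⟨ρ₂, hρ₂⟩ * ⟨q, hq⟩ : ZLam)
    (-(⟨ρ₂, hρ₂⟩ * ⟨p, hp⟩)) ⟨ρ₁, hρ₁⟩ (fun h => hρ₁0 (congrArg Subtype.val h)) (by
      intro π hπ h1 h2 h3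
      obtain ⟨a, ha, b, hb, hab⟩ := hρ.bezout
      obtain ⟨a', ha', b', hb', hab'⟩ := hpq.bezout
      have n2 : ¬ π ∣ (⟨ρ₂, hρ₂⟩ : ZLam) := fun h2 => hπ.not_isUnit <| isUnit_of_dvd_one <| by
        have := dvd_add (h3.mul_left ⟨a, ha⟩) (h2.mul_left ⟨b, hb⟩)
        convert this
        exact Subtype.ext hab.symm
      have hq' := (hπ.dvd_or_dvd h1).resolve_left n2
      have hp' := (hπ.dvd_or_dvd (dvd_neg.1 h2)).resolve_left n2
      refine hπ.not_isUnit <| isUnit_of_dvd_one ?_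
      have := dvd_add (hp'.mul_left ⟨a', ha'⟩) (hq'.mul_left ⟨b', hb'⟩)
      convert this
      exact Subtype.ext hab'.symm)
  have huw' : (u : ℝ) * (ρ₂ * (q * x - p)) + w * ρ₁ = 1 := by
    have := congrArg Subtype.val huw
    push_cast at this
    linear_combination this
  have hv : ρ₂ * (q * x - p) ∈ ZLam :=
    ZLam.mul_mem hρ₂ (ZLam.sub_mem (ZLam.mul_mem hq x.2) hp)
  obtain ⟨a, c, d, hac, hd, ea, ec⟩ := exists_isCol hv hρ₁
  have hdu : IsUnitZLam d := by
    refine ⟨hd, u * a + w * c, ZLam.add_mem (ZLam.mul_mem u.2 hac.mem.1)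
      (ZLam.mul_mem w.2 hac.mem.2), ?_⟩
    rw [ea] at huw'
    linear_combination huw' - w * ec
  have hd0 : d ≠ 0 := by rintro rfl; exact hρ₁0 (by rw [ec, zero_mul])
  obtain ⟨a₂, c₂, κ₂, hac₂, hκ₂, -, e5, e6⟩ := hg _ _ hac
  rw [e1] at e5
  rw [h10, e2] at e6
  have hdet' : μ * (ν * q) = 1 := by rw [← e2]; exact hdet
  have e5' : μ * d * κ₂ * a₂ = ρ₁ * x := by
    have h1 : ρ₁ * (μ * d * κ₂ * a₂) = ρ₁ * (ρ₁ * x) := by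
      linear_combination -μ * d * ρ₁ * e5 - μ * μ * ρ₁ * ea - μ * ν * p * ρ₁ * ec +
        μ * ρ₁ * (q * x - p) * hμν + ρ₁ * ρ₁ * x * hdet'
    exact mul_left_cancel₀ hρ₁0 h1
  have e6' : μ * d * κ₂ * c₂ = ρ₁ := by
    linear_combination -μ * d * e6 - μ * ν * q * ec + ρ₁ * hdet'
  have hc₂ : IsUnitZLam c₂ := by
    have hne : μ * d * κ₂ ≠ 0 := by positivity
    refine hac₂.isUnitZLam x.2 ZLam.one_mem ⟨0, ZLam.zero_mem, 1, ZLam.one_mem, by simp⟩ ?_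
      (mul_one _).symm
    apply mul_left_cancel₀ hne
    rw [e5', ← e6']; ring
  obtain ⟨A, hA, rfl, rfl⟩ := hac
  obtain ⟨B, hB, rfl, rfl⟩ := hac₂
  have hBi := SLG5.inv_mem hB
  obtain ⟨i1, i2, i3, i4⟩ := inv_entries B
  -- A and B move ∞ to the chosen cusp and to its image. The product is upper triangular, and its
  -- second column is ν/ρ₂ times a vector over ℤ[λ] whose last entry is a unit.
  have key : B⁻¹ * g * A ∈ SLG5 := by
    have dA := det_eq A
    have dB := det_eq B
    have mA := fun i j => entry_mem hA i j
    have mB := fun i j => entry_mem hB i j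
    have s1 : ρ₁ * A 0 1 + ρ₂ * p * A 1 1 ∈ ZLam :=
      ZLam.add_mem (ZLam.mul_mem hρ₁ (mA _ _)) (ZLam.mul_mem (ZLam.mul_mem hρ₂ hp) (mA _ _))
    have s2 : ρ₂ * q * A 1 1 ∈ ZLam := ZLam.mul_mem (ZLam.mul_mem hρ₂ hq) (mA _ _)
    have f1 : μ = ν / ρ₂ * ρ₁ := by field_simp; linear_combination hμν
    have f2 : ν = ν / ρ₂ * ρ₂ := by field_simp
    have g10 : (B⁻¹ * g * A) 1 0 = 0 := by
      simp only [mul_entry, i3, i4, h10, e1, e2, ← hμdef]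
      linear_combination B 0 0 * e6 - B 1 0 * e5
    have g00 : (B⁻¹ * g * A) 0 0 = κ₂ := by
      simp only [mul_entry, i1, i2, h10, e1, e2, ← hμdef]
      linear_combination B 1 1 * e5 - B 0 1 * e6 + κ₂ * dB
    refine ((hg.mul_left hBi).mul_right hA).mem_of_upper (κ := ν / ρ₂)
      (y₂ := B 1 1 * (ρ₁ * A 0 1 + ρ₂ * p * A 1 1) - B 0 1 * (ρ₂ * q * A 1 1))
      (y₃ := B 1 0 * d) g10 (ZLam.sub_mem (ZLam.mul_mem (mB _ _) s1) (ZLam.mul_mem (mB _ _) s2))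
      (hc₂.mul hdu) ?_ ?_
    · simp only [mul_entry, i1, i2, h10, e1, e2, ← hμdef]
      linear_combination B 1 1 * A 0 1 * f1 + (B 1 1 * A 1 1 * p - B 0 1 * A 1 1 * q) * f2
    · have hd1 := det_eq (B⁻¹ * g * A)
      rw [g10, g00, mul_zero, sub_zero] at hd1
      have hd2 : κ₂ * (ν / ρ₂ * (B 1 0 * d)) = 1 := by
        apply mul_left_cancel₀ hμ
        rw [f1]
        rw [f1] at e6'
        linear_combination ν / ρ₂ * e6'
      exact mul_left_cancel₀ hκ₂ (hd1.trans hd2.symm)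
  have := (Subgroup.mul_mem_cancel_right _ hA).1 key
  exact (Subgroup.mul_mem_cancel_left _ hBi).1 this

/-- A matrix that conjugates powers of all parabolic elements of the Hecke group into the Hecke
group is in the Hecke group. -/
lemma mem_of_conj_parabolic {g : Matrix.SpecialLinearGroup (Fin 2) ℝ} {m : ℕ} (hm : 0 < m)
    (h : ∀ A ∈ SLG5, g * (A * upper (m * lam) * A⁻¹) * g⁻¹ ∈ SLG5) : g ∈ SLG5 := by
  refine PermutesCols.mem ?_
  rintro p q ⟨A, hA, rfl, rfl⟩
  have hl := lam_pos
  have hm' : (m : ℝ) ≠ 0 := by exact_mod_cast hm.ne'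
  have hD := h A hA
  set C := g * A with hC
  have eD : g * (A * upper (m * lam) * A⁻¹) * g⁻¹ = C * upper (m * lam) * C⁻¹ := by
    rw [hC]; group
  rw [eD] at hD
  obtain ⟨c1, c2, c3, c4⟩ := inv_entries C
  have dC := det_eq C
  have D00 : (C * upper (m * lam) * C⁻¹) 0 0 = 1 - m * lam * (C 0 0 * C 1 0) := by
    simp only [mul_entry, c1, c3]; simp [upper]; linear_combination dC
  have D10 : (C * upper (m * lam) * C⁻¹) 1 0 = -(m * lam * (C 1 0 * C 1 0)) := by
    simp only [mul_entry, c1, c3]; simp [upper]; ring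
  rw [← mul_entry, ← mul_entry, ← hC]
  -- The conjugated parabolic has entries in ℤ[λ], and these determine its fixed point C 0 0 / C 1
  -- 0, which is therefore ∞ or in ℚ(λ), hence a cusp.
  obtain ⟨p', q', ν, hpq, hν, e1, e2⟩ : ∃ p' q' ν : ℝ, IsCol p' q' ∧ ν ≠ 0 ∧
      C 0 0 = ν * p' ∧ C 1 0 = ν * q' := by
    by_cases h0 : C 1 0 = 0
    · refine ⟨1, 0, C 0 0, .one_zero, ?_, by simp, by simp [h0]⟩
      rintro h1
      rw [h0, h1] at dC; simp at dC
    · have m0 : m * lam * (C 0 0 * C 1 0) ∈ ZLam := by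
        have := ZLam.sub_mem ZLam.one_mem (entry_mem hD 0 0)
        rwa [D00, sub_sub_cancel] at this
      have m1 : m * lam * (C 1 0 * C 1 0) ∈ ZLam := by
        have := ZLam.neg_mem (entry_mem hD 1 0)
        rwa [D10, neg_neg] at this
      obtain ⟨p', q', d, hpq, hd, e1, e2⟩ := exists_isCol m0 m1
      have hd0 : d ≠ 0 := by
        rintro rfl
        rw [zero_mul] at e2
        exact (mul_ne_zero (mul_ne_zero hm' hl.ne') (mul_ne_zero h0 h0)) e2
      refine ⟨p', q', d / (m * lam * C 1 0), hpq, by positivity, ?_, ?_⟩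
      · field_simp; linear_combination e1
      · field_simp; linear_combination e2
  -- After moving this cusp to ∞, the parabolic is translation by mλν². As it lies in G₅, mν² is an
  -- integer.
  refine ⟨p', q', ν, hpq, hν, ?_, e1, e2⟩
  obtain ⟨B, hB, rfl, rfl⟩ := hpq
  obtain ⟨b1, b2, b3, b4⟩ := inv_entries B
  have dB := det_eq B
  set E := B⁻¹ * C with hE
  have hE0 : E 0 0 = ν := by
    rw [hE, mul_entry, b1, b2, e1, e2]; linear_combination ν * dB
  have hE1 : E 1 0 = 0 := by
    rw [hE, mul_entry, b3, b4, e1, e2]; ring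
  have hF := SLG5.mul_mem (SLG5.mul_mem (SLG5.inv_mem hB) hD) hB
  have eF : B⁻¹ * (C * upper (m * lam) * C⁻¹) * B = E * upper (m * lam) * E⁻¹ := by
    rw [hE]; group
  rw [eF] at hF
  obtain ⟨c1, c2, c3, c4⟩ := inv_entries E
  have dE := det_eq E
  rw [hE0, hE1] at dE
  have F01 : (E * upper (m * lam) * E⁻¹) 0 1 = m * lam * ν ^ 2 := by
    simp only [mul_entry, c2, c4, hE0]; simp [upper]; ring
  have F11 : (E * upper (m * lam) * E⁻¹) 1 1 = 1 := by
    simp only [mul_entry, c2, c4, hE0, hE1]; simp [upper]; linear_combination dE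
  have hcol := IsCol.of_second hF
  rw [F01, F11] at hcol
  obtain ⟨k, hk⟩ := hcol.of_snd_eq_one (by simp)
  refine ⟨k / m, ?_⟩
  push_cast
  rw [eq_div_iff hm']
  apply mul_left_cancel₀ hl.ne'
  linear_combination hk

/-! ### The normaliser of `G₀(τ)` -/

/-- The entries of a matrix in the preimage of `G₅`, as elements of `ℤ[λ]`. -/
noncomputable def ent {A : Matrix.SpecialLinearGroup (Fin 2) ℝ} (hA : A ∈ SLG5) (i j : Fin 2) :
    ZLam := ⟨A i j, entry_mem hA i j⟩

lemma ent_det {A : Matrix.SpecialLinearGroup (Fin 2) ℝ} (hA : A ∈ SLG5) :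
    ent hA 0 0 * ent hA 1 1 - ent hA 0 1 * ent hA 1 0 = 1 := Subtype.ext (det_eq A)

lemma toPSL_mem_G0 {τ : ZLam} {A : Matrix.SpecialLinearGroup (Fin 2) ℝ} (hA : A ∈ SLG5) :
    toPSL A ∈ G0 τ ↔ τ ∣ ent hA 1 0 := by
  constructor
  · rintro ⟨-, B, hB, k, hk⟩
    rcases toPSL_eq_iff.1 hB with rfl | rfl
    · exact ⟨k, Subtype.ext hk⟩
    · exact ⟨-k, Subtype.ext (by
        rw [mul_neg, NegMemClass.coe_neg, ← hk]; simp [ent])⟩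
  · rintro ⟨k, hk⟩
    exact ⟨hA, A, rfl, k, congrArg Subtype.val hk⟩

lemma mem_SLG5_of_mem_G0 {τ : ZLam} {A : Matrix.SpecialLinearGroup (Fin 2) ℝ}
    (h : toPSL A ∈ G0 τ) : A ∈ SLG5 := h.1

lemma conj_entry (B A : Matrix.SpecialLinearGroup (Fin 2) ℝ) :
    (B * A * B⁻¹) 1 0 =
      B 1 0 * B 1 1 * (A 0 0 - A 1 1) + B 1 1 ^ 2 * A 1 0 - B 1 0 ^ 2 * A 0 1 := by
  obtain ⟨i1, i2, i3, i4⟩ := inv_entries B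
  simp only [mul_entry, i1, i3]; ring

lemma toPSL_conj_mem_G0 {τ : ZLam} {A B : Matrix.SpecialLinearGroup (Fin 2) ℝ} (hA : A ∈ SLG5)
    (hB : B ∈ SLG5) : toPSL B * toPSL A * (toPSL B)⁻¹ ∈ G0 τ ↔
      τ ∣ ent hB 1 0 * ent hB 1 1 * (ent hA 0 0 - ent hA 1 1) + ent hB 1 1 ^ 2 * ent hA 1 0 -
        ent hB 1 0 ^ 2 * ent hA 0 1 := by
  rw [← map_inv, ← map_mul, ← map_mul,
    toPSL_mem_G0 (SLG5.mul_mem (SLG5.mul_mem hB hA) (SLG5.inv_mem hB))]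
  rw [show ent (SLG5.mul_mem (SLG5.mul_mem hB hA) (SLG5.inv_mem hB)) 1 0 =
    ent hB 1 0 * ent hB 1 1 * (ent hA 0 0 - ent hA 1 1) + ent hB 1 1 ^ 2 * ent hA 1 0 -
      ent hB 1 0 ^ 2 * ent hA 0 1 from Subtype.ext (conj_entry B A)]

/-! #### The elements of `G₀(h σ)` are normalised by `G₀(σ)` -/

/-- With Q even, the invariant form gives P² ≡ 1 modulo 2. As 2 is prime, P ≡ 1 modulo 2, whence P²
≡ 1 modulo 4. -/
lemma four_dvd_sq_sub_one {A : Matrix.SpecialLinearGroup (Fin 2) ℝ} (hA : A ∈ SLG5)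
    (h : 2 ∣ ent hA 1 0) : 4 ∣ ent hA 0 0 ^ 2 - 1 := by
  obtain ⟨P, Q, K, hP, hQ, e⟩ := (IsCol.of_first hA).nonnegCol.form
  have hP' : P ^ 2 = ent hA 0 0 ^ 2 := Subtype.ext (by push_cast; rw [hP, sq_abs]; rfl)
  have hQ2 : 2 ∣ Q := by
    rcases abs_choice (A 1 0) with h' | h' <;> rw [h'] at hQ
    · rwa [show Q = ent hA 1 0 from Subtype.ext hQ]
    · rw [show Q = -ent hA 1 0 from Subtype.ext hQ]; exact (dvd_neg).2 h
  obtain ⟨q, rfl⟩ := hQ2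
  have h2 : (2 : ZLam) ∣ (P - 1) ^ 2 :=
    ⟨K - gen * P * q - 2 * q ^ 2 - P + 1, by linear_combination e⟩
  obtain ⟨r, hr⟩ := prime_two.dvd_of_dvd_pow h2
  rw [← hP']
  refine ⟨r ^ 2 + r, ?_⟩
  rw [show P = 1 + 2 * r by linear_combination hr]; ring

lemma dvd_sub_of_dvd_four {A : Matrix.SpecialLinearGroup (Fin 2) ℝ} (hA : A ∈ SLG5) {d : ZLam}
    (hd : d ∣ 4) (h2 : 2 ∣ ent hA 1 0) (h : d ∣ ent hA 1 0) : d ∣ ent hA 0 0 - ent hA 1 1 := by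
  have h1 := hd.trans (four_dvd_sq_sub_one hA h2)
  have e : ent hA 0 0 - ent hA 1 1 =
      ent hA 1 1 * (ent hA 0 0 ^ 2 - 1) - ent hA 0 0 * ent hA 0 1 * ent hA 1 0 := by
    linear_combination -ent hA 0 0 * ent_det hA
  rw [e]
  exact dvd_sub (h1.mul_left _) (h.mul_left _)

lemma conj_mem_G0_mul {d σ : ZLam} (hd : d ∣ 4) (h2 : d ∣ 1 ∨ 2 ∣ d) (hdσ : d ∣ σ)
    {A B : Matrix.SpecialLinearGroup (Fin 2) ℝ} (hB : toPSL B ∈ G0 σ) (hA : toPSL A ∈ G0 (d * σ)) :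
    toPSL B * toPSL A * (toPSL B)⁻¹ ∈ G0 (d * σ) := by
  have hA' := mem_SLG5_of_mem_G0 hA
  have hB' := mem_SLG5_of_mem_G0 hB
  rw [toPSL_mem_G0 hA'] at hA
  rw [toPSL_mem_G0 hB'] at hB
  rw [toPSL_conj_mem_G0 hA' hB']
  have hxw : d ∣ ent hA' 0 0 - ent hA' 1 1 := by
    rcases h2 with h2 | h2
    · exact h2.trans (one_dvd _)
    · exact dvd_sub_of_dvd_four hA' hd ((h2.trans (dvd_mul_right _ _)).trans hA)
        ((dvd_mul_right _ _).trans hA)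
  refine dvd_sub (dvd_add ?_ (hA.mul_left _)) (Dvd.dvd.mul_right ?_ _)
  · rw [mul_comm d]; exact mul_dvd_mul (hB.mul_right _) hxw
  · rw [sq]; exact mul_dvd_mul (hdσ.trans hB) hB

/-! #### Elements of `G₀(m)` with prescribed diagonal -/

lemma lower_entries (x : ℝ) :
    lower x 0 0 = 1 ∧ lower x 0 1 = 0 ∧ lower x 1 0 = x ∧ lower x 1 1 = 1 := by
  simp [lower]

lemma exists_word (a b c d e : ℤ) : ∃ (A : Matrix.SpecialLinearGroup (Fin 2) ℝ) (hA : A ∈ SLG5),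
    ent hA 0 0 = 1 + a * b * gen ^ 2 + d * gen ^ 2 * (a + c + a * b * c * gen ^ 2) ∧
    ent hA 1 0 = gen * (a + c + a * b * c * gen ^ 2 +
      e * (1 + a * b * gen ^ 2 + d * gen ^ 2 * (a + c + a * b * c * gen ^ 2))) ∧
    ent hA 1 1 = 1 + b * c * gen ^ 2 + e * gen ^ 2 * (b + d + b * c * d * gen ^ 2) := by
  have hg : (gen : ℝ) = lam := rfl
  refine ⟨lower (e * lam) * (upper (d * lam) * (lower (c * lam) *
    (upper (b * lam) * lower (a * lam)))), SLG5.mul_mem (lower_lam_mem e)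
    (SLG5.mul_mem (upper_lam_mem d) (SLG5.mul_mem (lower_lam_mem c)
    (SLG5.mul_mem (upper_lam_mem b) (lower_lam_mem a)))), ?_, ?_, ?_⟩
  all_goals
    apply Subtype.ext
    simp only [ent, mul_entry, upper_entries, lower_entries]
    push_cast
    rw [hg]
    ring

/-- The hypothesis makes 3t idempotent modulo τ. Where 3t = 1, the parameters are 1, −3, 2, −1/3, 3
and the word is upper triangular with diagonal λ³, λ⁻³, of difference 4. Where 3t = 0, only the
upper unipotent factor with parameter d survives. -/
lemma dvd_word_three {S : Type*} [CommRing S] {τ l : S} {t : ℤ} (ht : τ ∣ 9 * t ^ 2 - 3 * t)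
    (hl : l ^ 2 = l + 1) {a b c d e : ℤ} (ha : a = 3 * t) (hb : b = -(9 * t)) (hc : c = 6 * t)
    (hd : d = -t) (he : e = 9 * t)
    {x : S} (hx : x = 1 + a * b * l ^ 2 + d * l ^ 2 * (a + c + a * b * c * l ^ 2)) :
    τ ∣ l * (a + c + a * b * c * l ^ 2 + e * x) ∧
    τ ∣ x - (1 + b * c * l ^ 2 + e * l ^ 2 * (b + d + b * c * d * l ^ 2)) - 12 * t := by
  subst_vars
  simp only [← Ideal.mem_span_singleton, ← Ideal.Quotient.eq_zero_iff_mem] at ht ⊢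
  generalize Ideal.Quotient.mk (Ideal.span {τ}) = φ at ht ⊢
  have hl' : φ l ^ 2 = φ l + 1 := by rw [← map_pow, hl, map_add, map_one]
  simp only [map_sub, map_mul, map_neg, map_add, map_pow,
    map_one, map_ofNat, map_intCast, Int.cast_mul, Int.cast_neg, Int.cast_ofNat] at ht ⊢
  generalize φ l = m at hl' ⊢
  constructor <;> grind

/-- The same with 2t idempotent: where 2t = 1, the parameters are −1, 2, 1, −1/2, 2 and the diagonal
is λ², λ⁻², of difference 2λ − 1 = √5. -/
lemma dvd_word_two {S : Type*} [CommRing S] {τ l : S} {t : ℤ} (ht : τ ∣ 4 * t ^ 2 - 2 * t)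
    (hl : l ^ 2 = l + 1) {a b c d e : ℤ} (ha : a = -(2 * t)) (hb : b = 4 * t) (hc : c = 2 * t)
    (hd : d = -t) (he : e = 4 * t)
    {x : S} (hx : x = 1 + a * b * l ^ 2 + d * l ^ 2 * (a + c + a * b * c * l ^ 2)) :
    τ ∣ l * (a + c + a * b * c * l ^ 2 + e * x) ∧
    τ ∣ x - (1 + b * c * l ^ 2 + e * l ^ 2 * (b + d + b * c * d * l ^ 2)) - 2 * t * (2 * l - 1) := by
  subst_vars
  simp only [← Ideal.mem_span_singleton, ← Ideal.Quotient.eq_zero_iff_mem] at ht ⊢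
  generalize Ideal.Quotient.mk (Ideal.span {τ}) = φ at ht ⊢
  have hl' : φ l ^ 2 = φ l + 1 := by rw [← map_pow, hl, map_add, map_one]
  simp only [map_sub, map_mul, map_neg, map_add, map_pow,
    map_one, map_ofNat, map_intCast, Int.cast_mul, Int.cast_neg, Int.cast_ofNat] at ht ⊢
  generalize φ l = m at hl' ⊢
  constructor <;> grind

lemma exists_diag_three {τ : ZLam} {t : ℤ} (ht : τ ∣ 9 * t ^ 2 - 3 * t) :
    ∃ (A : Matrix.SpecialLinearGroup (Fin 2) ℝ) (hA : A ∈ SLG5), τ ∣ ent hA 1 0 ∧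
      τ ∣ ent hA 0 0 - ent hA 1 1 - 12 * t := by
  obtain ⟨A, hA, e1, e2, e3⟩ := exists_word (3 * t) (-(9 * t)) (6 * t) (-t) (9 * t)
  obtain ⟨w1, w2⟩ := dvd_word_three ht gen_sq rfl rfl rfl rfl rfl rfl
  refine ⟨A, hA, ?_, ?_⟩
  · rw [e2]; exact w1
  · rw [e1, e3]; exact w2

lemma exists_diag_two {τ : ZLam} {t : ℤ} (ht : τ ∣ 4 * t ^ 2 - 2 * t) :
    ∃ (A : Matrix.SpecialLinearGroup (Fin 2) ℝ) (hA : A ∈ SLG5), τ ∣ ent hA 1 0 ∧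
      τ ∣ ent hA 0 0 - ent hA 1 1 - 2 * t * (2 * gen - 1) := by
  obtain ⟨A, hA, e1, e2, e3⟩ := exists_word (-(2 * t)) (4 * t) (2 * t) (-t) (4 * t)
  obtain ⟨w1, w2⟩ := dvd_word_two ht gen_sq rfl rfl rfl rfl rfl rfl
  refine ⟨A, hA, ?_, ?_⟩
  · rw [e2]; exact w1
  · rw [e1, e3]; exact w2

lemma exists_pos_nat_mul {τ : ZLam} (hτ : τ ≠ 0) : ∃ m : ℕ, 0 < m ∧ τ ∣ (m : ZLam) := by
  obtain ⟨a, b, rfl⟩ := exists_int_add_mul_gen τ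
  have e : ((a : ZLam) + b * gen) * (a + b * (1 - gen)) = ((a ^ 2 + a * b - b ^ 2 : ℤ) : ZLam) := by
    push_cast; linear_combination -(b : ZLam) ^ 2 * gen_sq
  refine ⟨(a ^ 2 + a * b - b ^ 2).natAbs, Int.natAbs_pos.2 fun h0 => ?_, ?_⟩
  · rw [h0, Int.cast_zero] at e
    rcases mul_eq_zero.1 e with h | h
    · exact hτ h
    · have := int_add_mul_gen_inj (a := a + b) (b := -b) (c := 0) (d := 0)
        (by push_cast; linear_combination h)
      apply hτ
      rw [show b = 0 by omega, show a = 0 by omega]; simp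
  · have hd : ((a : ZLam) + b * gen) ∣ ((a ^ 2 + a * b - b ^ 2 : ℤ) : ZLam) := ⟨_, e.symm⟩
    rw [← Int.cast_natCast, Int.natCast_natAbs]
    rcases abs_choice (a ^ 2 + a * b - b ^ 2) with h | h <;> rw [h]
    · exact hd
    · rw [Int.cast_neg]; exact (dvd_neg).2 hd

/-- If `p` is a prime, then for every `m ≠ 0` there is an integer `t` such that `p t` is an
idempotent modulo `m`, and such that modulo `m` the idempotent `1 - p t` is annihilated by a power
of `p`. -/
lemma exists_idempotent (p : ℤ) (hp : Prime p) {m : ℤ} (hm : m ≠ 0) :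
    ∃ (t v m' : ℤ) (k : ℕ), m = p ^ k * m' ∧ p * t + v * m' = 1 ∧ m ∣ (p * t) ^ 2 - p * t := by
  obtain ⟨k, m', hpm, rfl⟩ := WfDvdMonoid.max_power_factor hm hp.irreducible
  have hcop : IsCoprime (p ^ (k + 1)) m' :=
    (hp.irreducible.coprime_iff_not_dvd.2 hpm).pow_left
  obtain ⟨u, v, h⟩ := hcop
  refine ⟨u * p ^ k, v, m', k, rfl, by rw [← h]; ring, ⟨-(u * p * v), ?_⟩⟩
  linear_combination (u * p * p ^ k) * h

/-! ### Conditions on the lower left entry of a normalising element -/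

/-- Split m into its 3-part and the rest. Away from 3 the first word gives 4c. At 3 the second word
gives √5 · c, hence 5c, and 5 is invertible there. -/
lemma dvd_four_mul {τ c : ZLam} (hτ : τ ≠ 0)
    (h : ∀ (A : Matrix.SpecialLinearGroup (Fin 2) ℝ) (hA : A ∈ SLG5), τ ∣ ent hA 1 0 →
      τ ∣ c * (ent hA 0 0 - ent hA 1 1)) : τ ∣ 4 * c := by
  obtain ⟨m, hm, hτm⟩ := exists_pos_nat_mul hτ
  have hm0 : (m : ℤ) ≠ 0 := by omega
  have hm' : τ ∣ ((m : ℤ) : ZLam) := by simpa using hτm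
  obtain ⟨t, v, m₁, k, e1, e2, e3⟩ := exists_idempotent 3 Int.prime_three hm0
  obtain ⟨s, w, m₂, l, f1, f2, f3⟩ := exists_idempotent 2 Int.prime_two hm0
  have ht : τ ∣ 12 * t * c := by
    have : τ ∣ 9 * (t : ZLam) ^ 2 - 3 * t := by
      have := hm'.trans (Int.cast_dvd_cast _ _ e3)
      push_cast at this
      convert this using 1; ring
    obtain ⟨A, hA, h1, h2⟩ := exists_diag_three this
    have := dvd_sub (h A hA h1) (h2.mul_left c)
    convert this using 1; ring
  have hs : τ ∣ 10 * s * c := by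
    have : τ ∣ 4 * (s : ZLam) ^ 2 - 2 * s := by
      have := hm'.trans (Int.cast_dvd_cast _ _ f3)
      push_cast at this
      convert this using 1; ring
    obtain ⟨A, hA, h1, h2⟩ := exists_diag_two this
    -- The factor is √5, so the difference 2s√5 becomes the integer 10s.
    have := (dvd_sub (h A hA h1) (h2.mul_left c)).mul_left (2 * gen - 1)
    convert this using 1
    linear_combination -(8 * s * c) * gen_sq
  -- a combination of `12 t`, `10 s` and `m` equals `4`
  have hcop : IsCoprime (10 * s) (3 ^ k) := by
    rcases Nat.eq_zero_or_pos k with rfl | hk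
    · simpa using isCoprime_one_right
    refine IsCoprime.pow_right ?_
    have h3 : (3 : ℤ) ∣ m₂ := by
      have h3m : (3 : ℤ) ∣ 2 ^ l * m₂ := by
        rw [← f1, e1]; exact (dvd_pow_self 3 hk.ne').mul_right _
      refine (Int.prime_three.dvd_or_dvd h3m).resolve_left fun h => ?_
      have := Int.prime_three.dvd_of_dvd_pow h
      omega
    obtain ⟨q, hq⟩ := h3
    refine ⟨2, 10 * w * q - 3, ?_⟩
    rw [hq] at f2
    linear_combination 10 * f2
  obtain ⟨α, β, hαβ⟩ := hcop
  have e2' : (3 : ZLam) * t + v * m₁ = 1 := by exact_mod_cast congrArg (Int.cast : ℤ → ZLam) e2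
  have hαβ' : (α : ZLam) * (10 * s) + β * 3 ^ k = 1 := by
    exact_mod_cast congrArg (Int.cast : ℤ → ZLam) hαβ
  have hmc : τ ∣ 3 ^ k * m₁ * c := by
    have := hm'.mul_right c
    rw [e1] at this
    exact_mod_cast this
  have := dvd_add (dvd_add ht (hs.mul_left (4 * v * m₁ * α))) (hmc.mul_left (4 * v * β))
  convert this using 1
  linear_combination -4 * c * e2' - 4 * v * m₁ * c * hαβ'

/-- Only powers of 2 matter. For h = 4 the factor 4 cancels; for h = 1 and h = 2, maximality gives 4
∤ σ and 8 ∤ σ respectively, and the condition on c² supplies the missing factor 2. -/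
lemma dvd_of_dvd_four_mul_of_dvd_sq {σ c : ZLam} {h : ℕ} (h4 : h ∣ 4)
    (hmax : ∀ d : ℕ, d ∣ 4 → (d : ZLam) ^ 2 ∣ h * σ → d ≤ h) (hσ : (h : ZLam) ∣ σ)
    (h1 : h * σ ∣ 4 * c) (h2 : h * σ ∣ c ^ 2) : σ ∣ c := by
  have hp := prime_two
  have two_ne : (2 : ZLam) ≠ 0 := two_ne_zero
  have cancel : ∀ a b : ZLam, 2 * a ∣ 2 * b → a ∣ b := fun a b => (mul_dvd_mul_iff_left two_ne).1
  have odd_cancel : ∀ a b : ZLam, ¬ 2 ∣ a → a ∣ 2 * b → a ∣ b := by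
    rintro a b ha ⟨k, hk⟩
    obtain ⟨k', rfl⟩ := (hp.dvd_or_dvd (hk ▸ dvd_mul_right 2 b)).resolve_left ha
    exact ⟨k', mul_left_cancel₀ two_ne (by rw [hk]; ring)⟩
  have hle : h ≤ 4 := Nat.le_of_dvd (by norm_num) h4
  interval_cases h
  · omega
  · -- `4 ∤ σ`
    have h4σ : ¬ (4 : ZLam) ∣ σ := fun hd => by
      have := hmax 2 (by norm_num) (by push_cast; rw [one_mul]; convert hd using 1; norm_num)
      omega
    rw [Nat.cast_one, one_mul] at h1 h2
    rw [show (4 : ZLam) * c = 2 * (2 * c) by ring] at h1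
    by_cases hd : 2 ∣ σ
    · obtain ⟨ρ, rfl⟩ := hd
      have hρ : ¬ 2 ∣ ρ := fun ⟨k, hk⟩ => h4σ ⟨k, by rw [hk]; ring⟩
      obtain ⟨k, rfl⟩ := odd_cancel _ _ hρ (cancel _ _ h1)
      have h3 : 2 ∣ (ρ * k) ^ 2 := (dvd_mul_right _ _).trans h2
      obtain ⟨j, rfl⟩ := (hp.dvd_or_dvd (hp.dvd_of_dvd_pow h3)).resolve_left hρ
      exact ⟨j, by ring⟩
    · exact odd_cancel _ _ hd (odd_cancel _ _ hd h1)
  · -- `16 ∤ 2 σ`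
    obtain ⟨ρ, rfl⟩ := hσ
    push_cast at *
    have h4ρ : ¬ (4 : ZLam) ∣ ρ := fun ⟨k, hk⟩ => by
      have := hmax 4 (by norm_num) ⟨k, by rw [hk]; push_cast; ring⟩
      omega
    rw [show (4 : ZLam) * c = 2 * (2 * c) by ring] at h1
    obtain ⟨k, rfl⟩ := cancel _ _ (cancel _ _ h1)
    have hρ0 : ρ ≠ 0 := fun h0 => h4ρ (h0 ▸ dvd_zero 4)
    obtain ⟨j, hj⟩ := h2
    have h3 : ρ * k ^ 2 = 4 * j := mul_left_cancel₀ hρ0 (by linear_combination hj)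
    have hk : 2 ∣ k := by
      by_contra hk
      have h5 : ∀ a : ZLam, 2 ∣ a * k ^ 2 → 2 ∣ a := fun a h =>
        (hp.dvd_or_dvd h).resolve_right fun h => hk (hp.dvd_of_dvd_pow h)
      obtain ⟨ρ', rfl⟩ := h5 ρ ⟨2 * j, by rw [h3]; ring⟩
      obtain ⟨ρ'', rfl⟩ := h5 ρ' ⟨j, mul_left_cancel₀ two_ne (by linear_combination h3)⟩
      exact h4ρ ⟨ρ'', by ring⟩
    obtain ⟨i, rfl⟩ := hk
    exact ⟨i, by ring⟩
  · omega
  · exact (mul_dvd_mul_iff_left (by norm_num : (4 : ZLam) ≠ 0)).1 (by exact_mod_cast h1)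

lemma mem_SLG5_of_mem_normalizer {τ : ZLam} (hτ : τ ≠ 0)
    {B : Matrix.SpecialLinearGroup (Fin 2) ℝ}
    (hB : toPSL B ∈ Subgroup.normalizer (G0 τ : Set PSL2R)) : B ∈ SLG5 := by
  obtain ⟨m, hm, k, hk⟩ := exists_pos_nat_mul hτ
  refine mem_of_conj_parabolic hm fun A hA => ?_
  have hU : upper (m * lam) ∈ SLG5 := by exact_mod_cast upper_lam_mem m
  have hP := SLG5.mul_mem (SLG5.mul_mem hA hU) (SLG5.inv_mem hA)
  have hmem : toPSL (A * upper (m * lam) * A⁻¹) ∈ G0 τ := by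
    rw [toPSL_mem_G0 hP]
    refine ⟨-(k * gen * ent hA 1 0 ^ 2), Subtype.ext ?_⟩
    have hk' : (m : ℝ) = τ * k := by exact_mod_cast congrArg Subtype.val hk
    refine (conj_entry _ _).trans ?_
    obtain ⟨u1, u2, u3, u4⟩ := upper_entries (m * lam)
    rw [u1, u2, u3, u4, hk']
    push_cast
    rw [show (gen : ℝ) = lam from rfl, show (ent hA 1 0 : ℝ) = A 1 0 from rfl]
    ring
  have := (Subgroup.mem_normalizer_iff.1 hB _).1 hmem
  rw [← map_inv, ← map_mul, ← map_mul] at this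
  exact mem_SLG5_of_mem_G0 this

end HeckeFive

theorem theorem6p1 (τ : HeckeFive.ZLam) (hτ : τ ≠ 0) (h : ℕ)
    (hh : IsGreatest {d : ℕ | d ∣ 4 ∧ (d : HeckeFive.ZLam) ^ 2 ∣ τ} h) :
    ∃ σ : HeckeFive.ZLam, τ = (h : HeckeFive.ZLam) * σ ∧
      Subgroup.normalizer (HeckeFive.G0 τ : Set HeckeFive.PSL2R) = HeckeFive.G0 σ := by
  open HeckeFive in
  obtain ⟨⟨h4, k, rfl⟩, hmax⟩ := hh
  obtain ⟨σ, hσ⟩ : ∃ σ : ZLam, σ = h * k := ⟨_, rfl⟩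
  have hhσ : (h : ZLam) ∣ σ := ⟨k, hσ⟩
  have e : (h : ZLam) ^ 2 * k = h * σ := by rw [hσ]; ring
  rw [e] at hτ hmax ⊢
  refine ⟨σ, rfl, le_antisymm ?_ ?_⟩
  · intro g hg
    obtain ⟨B, rfl⟩ := QuotientGroup.mk'_surjective _ g
    change toPSL B ∈ _ at hg
    change toPSL B ∈ _
    have hB := mem_SLG5_of_mem_normalizer hτ hg
    have hconj : ∀ (A : Matrix.SpecialLinearGroup (Fin 2) ℝ) (hA : A ∈ SLG5),
        h * σ ∣ ent hA 1 0 → h * σ ∣ ent hB 1 0 * ent hB 1 1 * (ent hA 0 0 - ent hA 1 1) +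
          ent hB 1 1 ^ 2 * ent hA 1 0 - ent hB 1 0 ^ 2 * ent hA 0 1 := fun A hA hd =>
      (toPSL_conj_mem_G0 hA hB).1
        ((Subgroup.mem_normalizer_iff.1 hg _).1 ((toPSL_mem_G0 hA).2 hd))
    have hsq : h * σ ∣ ent hB 1 0 ^ 2 := by
      have h0 : ent matT_mem 1 0 = 0 := Subtype.ext (by simp [ent, matT])
      have h1 : ent matT_mem 0 0 = ent matT_mem 1 1 := Subtype.ext (by simp [ent, matT])
      have h2 : ent matT_mem 0 1 = gen := Subtype.ext (by simp [ent, matT, gen])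
      -- Conjugating T leaves −λc², and λ is a unit with inverse λ − 1.
      have := hconj matT matT_mem (h0 ▸ dvd_zero _)
      rw [h0, h1, h2] at this
      have := this.mul_left (-(gen - 1))
      convert this using 1
      linear_combination -ent hB 1 0 ^ 2 * gen_sq
    rw [toPSL_mem_G0 hB]
    refine dvd_of_dvd_four_mul_of_dvd_sq h4 (fun d hd hd' => hmax ⟨hd, hd'⟩) hhσ
      (dvd_four_mul hτ fun A hA hd => ?_) hsq
    -- Multiplying by B 0 0 and using det B = 1 removes the factor B 1 1 from the main term, up to
    -- multiples of (B 1 0)².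
    have := dvd_sub (((hconj A hA hd).sub (hd.mul_left (ent hB 1 1 ^ 2))).mul_left (ent hB 0 0))
      (hsq.mul_left (ent hB 0 1 * (ent hA 0 0 - ent hA 1 1) - ent hB 0 0 * ent hA 0 1))
    convert this using 1
    linear_combination -ent hB 1 0 * (ent hA 0 0 - ent hA 1 1) * ent_det hB
  · intro g hg
    have h2 : (h : ZLam) ∣ 1 ∨ 2 ∣ (h : ZLam) := by
      have hle : h ≤ 4 := Nat.le_of_dvd (by norm_num) h4
      interval_cases h
      · omega
      · left; simp
      · right; simp
      · omega
      · right; exact ⟨2, by norm_num⟩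
    have hd4 : (h : ZLam) ∣ 4 := by exact_mod_cast Nat.cast_dvd_cast (α := ZLam) h4
    have key : ∀ g ∈ G0 σ, ∀ a ∈ G0 (h * σ), g * a * g⁻¹ ∈ G0 (h * σ) := by
      intro g hg a ha
      obtain ⟨B, rfl⟩ := QuotientGroup.mk'_surjective _ g
      obtain ⟨A, rfl⟩ := QuotientGroup.mk'_surjective _ a
      exact conj_mem_G0_mul hd4 h2 hhσ hg ha
    rw [Subgroup.mem_normalizer_iff]
    refine fun a => ⟨key g hg a, fun ha => ?_⟩
    have := key g⁻¹ (inv_mem hg) _ ha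
    simpa [mul_assoc] using this
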